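/- A knot diagram is an oriented smooth immersion of $S^1$ in $\mathbb R^2$ whose only multiple points are transversal double points, each decorated with over- /undercrossing information; parametrizations that differ by an orientation-preserving diffeomorphism of $S^1$ give the same diagram. The inverse of a diagram is the same diagram with the orientation of the strand reversed. Diagrams are transformed by orientation-preserving diffeomorphisms of the plane and by Reidemeister moves $\Omega_1,\Omega_2,\Omega_3$ inside disks of the plane (with all orientations of the strands, all choices of crossings and their mirror images). In the changing disk of an $\Omega_3$-move there are a top strand (crossing over the two others), a middle strand and a bottom strand (crossing under the two others); the move is called descending if, following the orientation of the knot, the three strands are passed in the cyclic order top, middle, bottom, and ascending otherwise. Theorem. Let $K$ be a figure eight knot diagram, that is, a plane knot diagram with exactly four crossings, alternating between over- and undercrossings along the knot, whose crossings are met along the knot in the cyclic order $1\,2\,3\,1\,4\,3\,2\,4$. Then any finite sequence of Reidemeister moves and orientation-preserving diffeomorphisms of the plane that transforms $K$ into its inverse contains both an ascending and a descending $\Omega_3$-move. In particular, it contains at least two $\Omega_3$-moves. -/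

import Mathlib

open scoped ContDiff

namespace PlaneKnot

/-- The plane. -/
abbrev Plane : Type := ℝ × ℝ

/-- The determinant of two plane vectors. -/
def cross (v w : Plane) : ℝ := v.1 * w.2 - v.2 * w.1

/-- Two real parameters represent the same point of the circle `ℝ/ℤ`. -/
def SameParam (s t : ℝ) : Prop := ∃ n : ℤ, t = s + n

/-- The parameters `s`, `t` are different points of the circle with the same image under `γ`. -/
def Crosses (γ : ℝ → Plane) (s t : ℝ) : Prop := γ s = γ t ∧ ¬ SameParam s t

/-- An oriented knot diagram: a smooth immersion of the circle `ℝ/ℤ` in the plane (written as a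
`1`-periodic map, oriented by increasing parameter) whose only multiple points are transversal
double points, together with the set `overpass` of those parameters at which the strand is the
overpassing one at a double point. -/
structure KnotDiagram where
  γ : ℝ → Plane
  smooth : ContDiff ℝ ∞ γ
  periodic : ∀ t, γ (t + 1) = γ t
  immersed : ∀ t, deriv γ t ≠ 0
  transversal : ∀ s t, Crosses γ s t → cross (deriv γ s) (deriv γ t) ≠ 0
  no_triple : ∀ r s t, Crosses γ r s → Crosses γ s t → ¬ Crosses γ r t
  overpass : Set ℝ
  overpass_periodic : ∀ t, t + 1 ∈ overpass ↔ t ∈ overpass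
  overpass_crosses : ∀ s ∈ overpass, ∃ t, Crosses γ s t
  overpass_iff : ∀ s t, Crosses γ s t → (s ∈ overpass ↔ t ∉ overpass)

/-- Orientation-preserving diffeomorphisms of the circle `ℝ/ℤ`, lifted to `ℝ`. -/
def IsCircleDiffeo (σ : ℝ → ℝ) : Prop :=
  ContDiff ℝ ∞ σ ∧ (∀ t, σ (t + 1) = σ t + 1) ∧ ∀ t, 0 < deriv σ t

/-- Orientation-preserving diffeomorphisms of the plane. -/
def IsPlaneDiffeo (F : Plane → Plane) : Prop :=
  ContDiff ℝ ∞ F ∧ (∃ G : Plane → Plane, ContDiff ℝ ∞ G ∧ (∀ p, G (F p) = p) ∧ ∀ p, F (G p) = p) ∧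
    ∀ p, 0 < (fderiv ℝ F p).det

namespace KnotDiagram

/-- Two parametrizations give the same diagram: the same oriented image with the same
over-undercrossing information. -/
def Same (K L : KnotDiagram) : Prop :=
  ∃ σ : ℝ → ℝ, IsCircleDiffeo σ ∧
    ∀ t, L.γ t = K.γ (σ t) ∧ (t ∈ L.overpass ↔ σ t ∈ K.overpass)

/-- Equivalence of diagrams: an orientation-preserving diffeomorphism of the plane takes one
diagram to the other. -/
def Equivalent (K L : KnotDiagram) : Prop :=
  ∃ F : Plane → Plane, IsPlaneDiffeo F ∧ ∃ σ : ℝ → ℝ, IsCircleDiffeo σ ∧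
    ∀ t, L.γ t = F (K.γ (σ t)) ∧ (t ∈ L.overpass ↔ σ t ∈ K.overpass)

theorem crosses_neg {γ : ℝ → Plane} {s t : ℝ} :
    Crosses (fun x => γ (-x)) s t ↔ Crosses γ (-s) (-t) := by
  unfold Crosses SameParam
  refine and_congr Iff.rfl (not_congr ⟨?_, ?_⟩)
  · rintro ⟨n, hn⟩
    exact ⟨-n, by push_cast; linarith⟩
  · rintro ⟨n, hn⟩
    exact ⟨-n, by push_cast; linarith⟩

/-- The inverse diagram: the orientation of the strand is reversed. -/
def inverse (K : KnotDiagram) : KnotDiagram where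
  γ := fun t => K.γ (-t)
  smooth := K.smooth.comp contDiff_neg
  periodic := fun t => by
    have h := K.periodic (-(t + 1))
    rw [← h]
    congr 1
    ring
  immersed := fun t => by
    rw [deriv_comp_neg]
    exact neg_ne_zero.mpr (K.immersed (-t))
  transversal := fun s t h => by
    rw [deriv_comp_neg, deriv_comp_neg]
    have := K.transversal _ _ (crosses_neg.mp h)
    simpa [cross] using this
  no_triple := fun r s t h₁ h₂ h₃ =>
    K.no_triple _ _ _ (crosses_neg.mp h₁) (crosses_neg.mp h₂) (crosses_neg.mp h₃)
  overpass := {t | -t ∈ K.overpass}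
  overpass_periodic := fun t => by
    have h := K.overpass_periodic (-(t + 1))
    have e : -(t + 1) + 1 = -t := by ring
    rw [e] at h
    exact h.symm
  overpass_crosses := fun s hs => by
    obtain ⟨t, ht⟩ := K.overpass_crosses _ hs
    exact ⟨-t, crosses_neg.mpr (by rwa [neg_neg])⟩
  overpass_iff := fun s t h => K.overpass_iff _ _ (crosses_neg.mp h)

/-- A figure eight knot diagram: the alternating diagram with four crossings which are met along
the knot in the cyclic order `1 2 3 1 4 3 2 4`. -/
def IsFigureEight (K : KnotDiagram) : Prop :=
  ∃ t : Fin 8 → ℝ, StrictMono t ∧ t 7 < t 0 + 1 ∧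
    K.γ (t 0) = K.γ (t 3) ∧ K.γ (t 1) = K.γ (t 6) ∧
    K.γ (t 2) = K.γ (t 5) ∧ K.γ (t 4) = K.γ (t 7) ∧
    (∀ r s, Crosses K.γ r s → ∃ i, SameParam (t i) r) ∧
    ((∀ i, t i ∈ K.overpass ↔ Even (i : ℕ)) ∨ (∀ i, t i ∈ K.overpass ↔ Odd (i : ℕ)))

end KnotDiagram

/-! ### Reidemeister moves -/

/-- The closed unit disk. -/
def unitDisk : Set Plane := {p | p.1 ^ 2 + p.2 ^ 2 ≤ 1}

/-- The boundary of the unit disk. -/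
def unitCircle : Set Plane := {p | p.1 ^ 2 + p.2 ^ 2 = 1}

/-- `φ` restricts to a diffeomorphism of the unit disk onto its image (a smooth map on the closed
disk is the restriction of a smooth map of the plane). -/
def IsDiskEmbedding (φ : Plane → Plane) : Prop :=
  ContDiff ℝ ∞ φ ∧ Set.InjOn φ unitDisk ∧ ∀ p ∈ unitDisk, (fderiv ℝ φ p).det ≠ 0

/-- The parameter `t` lies, modulo `1`, in one of the arcs `[a i, b i]`. -/
def InArcs {n : ℕ} (a b : Fin n → ℝ) (t : ℝ) : Prop :=
  ∃ i, ∃ s ∈ Set.Icc (a i) (b i), SameParam s t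

/-- The arcs `[a i, b i]` embed in the circle and are pairwise disjoint there. -/
def ArcsDisjoint {n : ℕ} (a b : Fin n → ℝ) : Prop :=
  ∀ i j, ∀ s ∈ Set.Icc (a i) (b i), ∀ t ∈ Set.Icc (a j) (b j), SameParam s t → i = j ∧ s = t

/-- The part of the diagram `K` in the disk `φ(unitDisk)` is the image under `φ` of the strands
`m i`, `-1 ≤ u ≤ 1`. The strand `m i` is the image of the arc `[a i, b i]`, run through in either
direction, and the rest of the diagram lies outside the disk. -/
def HasPart {n : ℕ} (K : KnotDiagram) (φ : Plane → Plane) (m : Fin n → ℝ → Plane)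
    (a b : Fin n → ℝ) : Prop :=
  (∀ i, ∃ u : ℝ → ℝ,
    (StrictMonoOn u (Set.Icc (a i) (b i)) ∨ StrictAntiOn u (Set.Icc (a i) (b i))) ∧
    u '' Set.Icc (a i) (b i) = Set.Icc (-1) 1 ∧
    ∀ t ∈ Set.Icc (a i) (b i), K.γ t = φ (m i (u t))) ∧
  ∀ t, ¬ InArcs a b t → K.γ t ∉ φ '' unitDisk

/-- The strands are layered: `ord 0` is the top strand, `ord 1` the next one, and so on. -/
def Layered {n : ℕ} (K : KnotDiagram) (ord : Equiv.Perm (Fin n)) (a b : Fin n → ℝ) : Prop :=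
  ∀ p q, p < q → ∀ s ∈ Set.Icc (a (ord p)) (b (ord p)), ∀ t ∈ Set.Icc (a (ord q)) (b (ord q)),
    K.γ s = K.γ t → s ∈ K.overpass

/-- `L` arises from `K` by replacing the part `m` inside a disk by the part `m'`; the
identifications `φ`, `ψ` of the changing disk with the unit disk agree on the boundary, and
nothing changes outside the changing disk. -/
def Replaces {n : ℕ} (m m' : Fin n → ℝ → Plane) (ord : Equiv.Perm (Fin n)) (a b : Fin n → ℝ)
    (K L : KnotDiagram) : Prop :=
  ArcsDisjoint a b ∧
  ∃ φ ψ : Plane → Plane, IsDiskEmbedding φ ∧ IsDiskEmbedding ψ ∧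
    φ '' unitDisk = ψ '' unitDisk ∧ Set.EqOn φ ψ unitCircle ∧
    HasPart K φ m a b ∧ HasPart L ψ m' a b ∧ Layered K ord a b ∧ Layered L ord a b ∧
    ∀ t, ¬ InArcs a b t → K.γ t = L.γ t ∧ (t ∈ K.overpass ↔ t ∈ L.overpass)

/-- A move between diagrams that exchanges, in one of the two directions, the parts `m` and `m'`,
where the layering of the strands and their position on the circle satisfy `P`. -/
def Move {n : ℕ} (m m' : Fin n → ℝ → Plane) (P : Equiv.Perm (Fin n) → (Fin n → ℝ) → Prop)
    (K L : KnotDiagram) : Prop :=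
  ∃ K' L' : KnotDiagram, K.Same K' ∧ L.Same L' ∧ ∃ ord a b, P ord a ∧
    (Replaces m m' ord a b K' L' ∨ Replaces m m' ord a b L' K')

/-- A strand without crossings. -/
noncomputable def omega1Plain : Fin 1 → ℝ → Plane := ![fun u => (u, 0)]

/-- A strand with a kink, which crosses itself at `u = -1/2` and `u = 1/2`. -/
noncomputable def omega1Kink : Fin 1 → ℝ → Plane :=
  ![fun u => (u * (4 * u ^ 2 - 1) / 3, (1 - u ^ 2) / 2)]

/-- Two disjoint strands. -/
noncomputable def omega2Plain : Fin 2 → ℝ → Plane :=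
  ![fun u => (4 * u / 5, 3 / 5), fun u => (4 * u / 5, -(3 / 5))]

/-- Two strands that cross each other at `u = -1/2` and `u = 1/2`. -/
noncomputable def omega2Crossed : Fin 2 → ℝ → Plane :=
  ![fun u => (4 * u / 5, (4 * u ^ 2 - 1) / 5), fun u => (4 * u / 5, -((4 * u ^ 2 - 1) / 5))]

/-- Two strands that cross at the origin and a third strand passing above the origin. -/
noncomputable def omega3Upper : Fin 3 → ℝ → Plane :=
  ![fun u => (3 * u / 5, 4 * u / 5), fun u => (3 * u / 5, -(4 * u / 5)),
    fun u => (u, (1 - u ^ 2) / 2)]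

/-- Two strands that cross at the origin and a third strand passing below the origin. -/
noncomputable def omega3Lower : Fin 3 → ℝ → Plane :=
  ![fun u => (3 * u / 5, 4 * u / 5), fun u => (3 * u / 5, -(4 * u / 5)),
    fun u => (u, -((1 - u ^ 2) / 2))]

/-- The points `x`, `y`, `z` of the circle `ℝ/ℤ` are distinct and met in this cyclic order. -/
def InCyclicOrder (x y z : ℝ) : Prop :=
  ∃ p q : ℤ, x < y + p ∧ y + p < z + q ∧ z + q < x + 1

/-- The `Ω₁`-moves. -/
def Omega1 : KnotDiagram → KnotDiagram → Prop := Move omega1Plain omega1Kink fun _ _ => True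

/-- The `Ω₂`-moves. -/
def Omega2 : KnotDiagram → KnotDiagram → Prop := Move omega2Plain omega2Crossed fun _ _ => True

/-- The descending `Ω₃`-moves: the strands are passed in the cyclic order top, middle, bottom. -/
def Omega3Descending : KnotDiagram → KnotDiagram → Prop :=
  Move omega3Upper omega3Lower fun ord a => InCyclicOrder (a (ord 0)) (a (ord 1)) (a (ord 2))

/-- The ascending `Ω₃`-moves: all the others. -/
def Omega3Ascending : KnotDiagram → KnotDiagram → Prop :=
  Move omega3Upper omega3Lower fun ord a => ¬ InCyclicOrder (a (ord 0)) (a (ord 1)) (a (ord 2))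

/-- The kinds of steps by which a diagram is transformed. -/
inductive StepKind where
  | equivalence
  | omega1
  | omega2
  | omega3Ascending
  | omega3Descending

/-- `K` is transformed to `L` by a step of the given kind. -/
def Step : StepKind → KnotDiagram → KnotDiagram → Prop
  | .equivalence => KnotDiagram.Equivalent
  | .omega1 => Omega1
  | .omega2 => Omega2
  | .omega3Ascending => Omega3Ascending
  | .omega3Descending => Omega3Descending

/-- The diagrams `D 0, D 1, …, D n` form a sequence of transformations, the `i`-th of which is a
step of kind `kind i`. -/
def IsTransformation {n : ℕ} (D : Fin (n + 1) → KnotDiagram) (kind : Fin n → StepKind) : Prop :=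
  ∀ i : Fin n, Step (kind i) (D i.castSucc) (D i.succ)

end PlaneKnot

/-! ### A concrete figure eight diagram, showing that the notion is not void -/

namespace PlaneKnot

open Real in
/-- A closed curve with the shape of a figure eight knot diagram. -/
noncomputable def eightCurve (t : ℝ) : Plane :=
  ((2 + cos (4 * π * t)) * cos (6 * π * t), (2 + cos (4 * π * t)) * sin (6 * π * t))

open Real in
theorem eightCurve_eq_iff (s t : ℝ) : eightCurve s = eightCurve t ↔
    cos (4 * π * s) = cos (4 * π * t) ∧ cos (6 * π * s) = cos (6 * π * t) ∧
      sin (6 * π * s) = sin (6 * π * t) := by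
  constructor
  · intro h
    have h1 := congrArg Prod.fst h
    have h2 := congrArg Prod.snd h
    simp only [eightCurve] at h1 h2
    have ps := neg_one_le_cos (4 * π * s)
    have pt := neg_one_le_cos (4 * π * t)
    have e : (2 + cos (4 * π * s)) ^ 2 = (2 + cos (4 * π * t)) ^ 2 := by
      linear_combination ((2 + cos (4 * π * s)) * cos (6 * π * s) +
        (2 + cos (4 * π * t)) * cos (6 * π * t)) * h1 +
        ((2 + cos (4 * π * s)) * sin (6 * π * s) +
        (2 + cos (4 * π * t)) * sin (6 * π * t)) * h2 -
        (2 + cos (4 * π * s)) ^ 2 * sin_sq_add_cos_sq (6 * π * s) +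
        (2 + cos (4 * π * t)) ^ 2 * sin_sq_add_cos_sq (6 * π * t)
    have e' : cos (4 * π * s) = cos (4 * π * t) := by nlinarith
    rw [e'] at h1 h2
    have hne : 2 + cos (4 * π * t) ≠ 0 := by linarith
    exact ⟨e', mul_left_cancel₀ hne h1, mul_left_cancel₀ hne h2⟩
  · rintro ⟨h1, h2, h3⟩
    simp [eightCurve, h1, h2, h3]

open Real in
theorem eightCurve_crosses {s t : ℝ} (h : Crosses eightCurve s t) :
    ∃ k n : ℤ, 2 * (s + t) = k ∧ 3 * (s - t) = n ∧ ¬ (3 ∣ n) := by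
  obtain ⟨h, hne⟩ := h
  obtain ⟨h1, h2, h3⟩ := (eightCurve_eq_iff s t).mp h
  have hp := pi_pos.ne'
  have h4 : cos (6 * π * s - 6 * π * t) = 1 := by
    rw [cos_sub, h2, h3]
    nlinarith [sin_sq_add_cos_sq (6 * π * t)]
  obtain ⟨n, hn⟩ := (cos_eq_one_iff _).mp h4
  have hn' : 3 * (s - t) = n := by
    apply mul_left_cancel₀ (mul_ne_zero two_ne_zero hp)
    linear_combination -hn
  obtain ⟨k, hk | hk⟩ := cos_eq_cos_iff.mp h1
  · exfalso
    have hk' : 2 * (t - s) = k := by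
      apply mul_left_cancel₀ (mul_ne_zero two_ne_zero hp)
      linear_combination hk
    exact hne ⟨-n - k, by push_cast; linarith⟩
  · refine ⟨k, n, ?_, hn', ?_⟩
    · apply mul_left_cancel₀ (mul_ne_zero two_ne_zero hp)
      linear_combination hk
    · rintro ⟨c, rfl⟩
      exact hne ⟨-c, by push_cast at hn' ⊢; linarith⟩

open Real in
theorem eightCurve_of {s t : ℝ} (k n : ℤ) (hk : 2 * (s + t) = k) (hn : 3 * (s - t) = n) :
    eightCurve s = eightCurve t := by
  rw [eightCurve_eq_iff]
  refine ⟨cos_eq_cos_iff.mpr ⟨k, Or.inr ?_⟩, ?_, ?_⟩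
  · rw [← hk]; ring
  · rw [show 6 * π * s = 6 * π * t + n * (2 * π) by rw [← hn]; ring, cos_add_int_mul_two_pi]
  · rw [show 6 * π * s = 6 * π * t + n * (2 * π) by rw [← hn]; ring, sin_add_int_mul_two_pi]

open Real in
theorem eightCurve_hasDerivAt (t : ℝ) : HasDerivAt eightCurve
    (-(sin (4 * π * t) * (4 * π)) * cos (6 * π * t) +
        (2 + cos (4 * π * t)) * -(sin (6 * π * t) * (6 * π)),
      -(sin (4 * π * t) * (4 * π)) * sin (6 * π * t) +
        (2 + cos (4 * π * t)) * (cos (6 * π * t) * (6 * π))) t := by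
  have l (c : ℝ) : HasDerivAt (fun x : ℝ => c * x) c t := by
    simpa using (hasDerivAt_id t).const_mul c
  have r : HasDerivAt (fun x => 2 + cos (4 * π * x)) (-(sin (4 * π * t) * (4 * π))) t := by
    simpa using ((l (4 * π)).cos).const_add 2
  have c : HasDerivAt (fun x => cos (6 * π * x)) (-(sin (6 * π * t) * (6 * π))) t := by
    simpa using (l (6 * π)).cos
  exact (r.mul c).prodMk (r.mul (l (6 * π)).sin)

open Real in
/-- A diagram of the figure eight knot (as a closed braid with three strands). -/
noncomputable def eightDiagram : KnotDiagram where
  γ := eightCurve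
  smooth := by unfold eightCurve; fun_prop
  periodic := fun t => by
    unfold eightCurve
    rw [show 4 * π * (t + 1) = 4 * π * t + (2 : ℤ) * (2 * π) by push_cast; ring,
      show 6 * π * (t + 1) = 6 * π * t + (3 : ℤ) * (2 * π) by push_cast; ring,
      cos_add_int_mul_two_pi, cos_add_int_mul_two_pi, sin_add_int_mul_two_pi]
  immersed := fun t h => by
    rw [(eightCurve_hasDerivAt t).deriv] at h
    have h1 := congrArg Prod.fst h
    have h2 := congrArg Prod.snd h
    simp only [Prod.fst_zero, Prod.snd_zero] at h1 h2
    have e : (2 + cos (4 * π * t)) * (6 * π) = 0 := by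
      linear_combination -sin (6 * π * t) * h1 + cos (6 * π * t) * h2 -
        (2 + cos (4 * π * t)) * (6 * π) * sin_sq_add_cos_sq (6 * π * t)
    have := neg_one_le_cos (4 * π * t)
    have := pi_pos
    have : 0 < (2 + cos (4 * π * t)) * (6 * π) := mul_pos (by linarith) (by linarith)
    linarith
  transversal := fun s t hc => by
    obtain ⟨h1, h2, h3⟩ := (eightCurve_eq_iff s t).mp hc.1
    obtain ⟨k, n, hk, hn, h3n⟩ := eightCurve_crosses hc
    have hs : sin (4 * π * t) = - sin (4 * π * s) := by
      rw [show 4 * π * t = k * (2 * π) - 4 * π * s by rw [← hk]; ring, sin_int_mul_two_pi_sub]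
    rw [(eightCurve_hasDerivAt t).deriv, (eightCurve_hasDerivAt s).deriv, ← h1, ← h2, ← h3, hs]
    intro h0
    simp only [cross] at h0
    have e : sin (4 * π * s) * ((2 + cos (4 * π * s)) * (48 * π ^ 2)) = 0 := by
      linear_combination -h0 - (sin (4 * π * s) * ((2 + cos (4 * π * s)) * (48 * π ^ 2))) *
        sin_sq_add_cos_sq (6 * π * s)
    have := neg_one_le_cos (4 * π * s)
    have := pi_pos
    have p : 0 < (2 + cos (4 * π * s)) * (48 * π ^ 2) := mul_pos (by linarith) (by positivity)
    obtain h | h := mul_eq_zero.mp e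
    · obtain ⟨m, hm⟩ := sin_eq_zero_iff.mp h
      have hm' : 4 * s = m := by
        apply mul_left_cancel₀ pi_pos.ne'
        linear_combination -hm
      have : (3 * m : ℤ) = 3 * k + 2 * n := by
        have : (3 * m : ℝ) = 3 * k + 2 * n := by rw [← hm', ← hk, ← hn]; ring
        exact_mod_cast this
      omega
    · exact p.ne' h
  no_triple := fun r s t h₁ h₂ h₃ => by
    obtain ⟨k, n, hk, hn, h⟩ := eightCurve_crosses h₁
    obtain ⟨k', n', hk', hn', h'⟩ := eightCurve_crosses h₂
    obtain ⟨k'', n'', hk'', hn'', h''⟩ := eightCurve_crosses h₃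
    have e1 : 3 * k - 2 * n = 3 * k' + 2 * n' := by
      have : (3 * k - 2 * n : ℝ) = 3 * k' + 2 * n' := by rw [← hk, ← hn, ← hk', ← hn']; ring
      exact_mod_cast this
    have e2 : 3 * k + 2 * n = 3 * k'' + 2 * n'' := by
      have : (3 * k + 2 * n : ℝ) = 3 * k'' + 2 * n'' := by rw [← hk, ← hn, ← hk'', ← hn'']; ring
      exact_mod_cast this
    have e3 : 3 * k' - 2 * n' = 3 * k'' - 2 * n'' := by
      have : (3 * k' - 2 * n' : ℝ) = 3 * k'' - 2 * n'' := by
        rw [← hk', ← hn', ← hk'', ← hn'']; ring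
      exact_mod_cast this
    omega
  overpass := {t | ∃ j : ℤ, 12 * t = 3 * j + 1}
  overpass_periodic := fun t => by
    constructor
    · rintro ⟨j, hj⟩
      exact ⟨j - 4, by push_cast; linarith⟩
    · rintro ⟨j, hj⟩
      exact ⟨j + 4, by push_cast; linarith⟩
  overpass_crosses := by
    rintro s ⟨j, hj⟩
    refine ⟨s + 1 / 3, eightCurve_of (j + 1) (-1) (by push_cast; linarith) (by push_cast; ring), ?_⟩
    rintro ⟨n, hn⟩
    have : (1 : ℤ) = 3 * n := by
      have : (1 : ℝ) = 3 * n := by linarith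
      exact_mod_cast this
    omega
  overpass_iff := fun s t h => by
    obtain ⟨k, n, hk, hn, h⟩ := eightCurve_crosses h
    have es : 12 * s = ((3 * k + 2 * n : ℤ) : ℝ) := by push_cast; rw [← hk, ← hn]; ring
    have et : 12 * t = ((3 * k - 2 * n : ℤ) : ℝ) := by push_cast; rw [← hk, ← hn]; ring
    have hmem (x : ℝ) (c : ℤ) (hx : 12 * x = c) :
        (x ∈ {t : ℝ | ∃ j : ℤ, 12 * t = 3 * j + 1}) ↔ c % 3 = 1 := by
      change (∃ j : ℤ, 12 * x = 3 * j + 1) ↔ _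
      rw [hx]
      constructor
      · rintro ⟨j, hj⟩
        have : c = 3 * j + 1 := by exact_mod_cast hj
        omega
      · intro hc
        refine ⟨c / 3, ?_⟩
        have : c = 3 * (c / 3) + 1 := by omega
        exact_mod_cast this
    rw [hmem s _ es, hmem t _ et]
    omega

theorem eightDiagram_isFigureEight : eightDiagram.IsFigureEight := by
  refine ⟨![1 / 12, 2 / 12, 4 / 12, 5 / 12, 7 / 12, 8 / 12, 10 / 12, 11 / 12], ?_, ?_,
    eightCurve_of 1 (-1) ?_ ?_, eightCurve_of 2 (-2) ?_ ?_, eightCurve_of 2 (-1) ?_ ?_,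
    eightCurve_of 3 (-1) ?_ ?_, ?_, Or.inl ?_⟩
  · rw [Fin.strictMono_iff_lt_succ]
    intro i
    fin_cases i <;> simp <;> norm_num
  all_goals try (simp; norm_num; done)
  · intro r s h
    obtain ⟨k, n, hk, hn, h3⟩ := eightCurve_crosses h
    have er : 12 * r = ((3 * k + 2 * n : ℤ) : ℝ) := by push_cast; rw [← hk, ← hn]; ring
    have h0 : ¬ 3 ∣ (3 * k + 2 * n) := by omega
    generalize 3 * k + 2 * n = c at er h0
    have hc : c % 12 = 1 ∨ c % 12 = 2 ∨ c % 12 = 4 ∨ c % 12 = 5 ∨ c % 12 = 7 ∨ c % 12 = 8 ∨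
        c % 12 = 10 ∨ c % 12 = 11 := by omega
    have e : (c : ℝ) = 12 * (c / 12 : ℤ) + (c % 12 : ℤ) := by
      exact_mod_cast (Int.mul_ediv_add_emod c 12).symm
    rcases hc with hc | hc | hc | hc | hc | hc | hc | hc <;> rw [hc] at e
    · exact ⟨0, c / 12, by simp; push_cast at e; linarith⟩
    · exact ⟨1, c / 12, by simp; push_cast at e; linarith⟩
    · exact ⟨2, c / 12, by simp; push_cast at e; linarith⟩
    · exact ⟨3, c / 12, by simp; push_cast at e; linarith⟩
    · exact ⟨4, c / 12, by simp; push_cast at e; linarith⟩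
    · exact ⟨5, c / 12, by simp; push_cast at e; linarith⟩
    · exact ⟨6, c / 12, by simp; push_cast at e; linarith⟩
    · exact ⟨7, c / 12, by simp; push_cast at e; linarith⟩
  · have hmem (x : ℝ) (c : ℤ) (hx : 12 * x = c) : x ∈ eightDiagram.overpass ↔ c % 3 = 1 := by
      change (∃ j : ℤ, 12 * x = 3 * j + 1) ↔ _
      rw [hx]
      constructor
      · rintro ⟨j, hj⟩
        have : c = 3 * j + 1 := by exact_mod_cast hj
        omega
      · intro hc
        refine ⟨c / 3, ?_⟩
        have : c = 3 * (c / 3) + 1 := by omega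
        exact_mod_cast this
    intro i
    fin_cases i
    · rw [hmem _ 1 (by simp)]; decide
    · rw [hmem _ 2 (by simp; norm_num)]; decide
    · rw [hmem _ 4 (by simp; norm_num)]; decide
    · rw [hmem _ 5 (by simp; norm_num)]; decide
    · rw [hmem _ 7 (by simp; norm_num)]; decide
    · rw [hmem _ 8 (by simp; norm_num)]; decide
    · rw [hmem _ 10 (by simp; norm_num)]; decide
    · rw [hmem _ 11 (by simp; norm_num)]; decide

end PlaneKnot

/-!
Draw an arrow in the Gauss diagram of `K` from the overcrossing to the undercrossing of each
crossing, and count modulo 2 the sets of four arrows whose eight ends lie on the circle in the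
cyclic order `o₀ u₂ o₁ u₃ o₂ u₀ o₃ u₁`, the `k`-th arrow leading from `oₖ` to `uₖ`. Diffeomorphisms
of the plane do not change the Gauss diagram. No arrow of such a set can be the short arrow of an
`Ω₁`-kink, no two of them can be the parallel arrows of an `Ω₂`-move, and these two can be exchanged
for each other in any set, so the sets destroyed by `Ω₂` come in pairs. For `Ω₃`, no set contains
two of the three arrows of a triangle passed in the order top, middle, bottom. Hence the parity can
only change in an ascending `Ω₃`-move. The four arrows of the figure eight form such a set in
exactly one of `K` and its inverse, so an ascending move is needed to pass from one to the other.
Reversing the strand in every diagram of the sequence exchanges ascending and descending moves,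
which gives the descending one.
-/

namespace PlaneKnot

open Set Function

section CircularOrder

variable {C : Type*} [CircularOrder C] {A B D : Set C} {x x' y y' z z' : C}

theorem sbtw_or_sbtw_swap (hxy : x ≠ y) (hyz : y ≠ z) (hzx : z ≠ x) :
    sbtw x y z ∨ sbtw z y x := by
  by_contra! h
  rw [← btw_iff_not_sbtw, ← btw_iff_not_sbtw] at h
  rcases h.1.antisymm h.2 with e | e | e
  exacts [hyz e.symm, hxy e.symm, hzx e.symm]

theorem sbtw_swap_iff_not (hxy : x ≠ y) (hyz : y ≠ z) (hzx : z ≠ x) :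
    sbtw z y x ↔ ¬ sbtw x y z :=
  ⟨fun h h' => sbtw_asymm h' h, (sbtw_or_sbtw_swap hxy hyz hzx).resolve_left⟩

/-- A set is an arc if with any two of its points it contains everything between them on one of the
two sides. -/
def IsArc (A : Set C) : Prop :=
  ∀ x ∈ A, ∀ y ∈ A, (∀ z, sbtw x z y → z ∈ A) ∨ ∀ z, sbtw y z x → z ∈ A

theorem IsArc.sbtw_of_mem (hA : IsArc A) (hx : x ∈ A) (hx' : x' ∈ A) (hy : y ∉ A) (hz : z ∉ A)
    (h : sbtw x y z) : sbtw x' y z := by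
  have hyz : y ≠ z := by
    rintro rfl
    exact sbtw_irrefl_right h
  refine (sbtw_or_sbtw_swap (ne_of_mem_of_not_mem hx' hy) hyz
    (ne_of_mem_of_not_mem hx' hz).symm).resolve_right fun h' => ?_
  have hyx'z : sbtw y x' z := h'.cyclic_left
  rcases hA x hx x' hx' with hmem | hmem
  · exact hy (hmem y (sbtw_cyclic_right (sbtw_trans_right hyx'z h.cyclic_left)))
  · exact hz (hmem z (h.trans_left hyx'z).cyclic_left)

theorem IsArc.sbtw_of_disjoint (hA : IsArc A) (hB : IsArc B) (hD : IsArc D) (hAB : Disjoint A B)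
    (hBD : Disjoint B D) (hDA : Disjoint D A) (hx : x ∈ A) (hx' : x' ∈ A) (hy : y ∈ B)
    (hy' : y' ∈ B) (hz : z ∈ D) (hz' : z' ∈ D) (h : sbtw x y z) : sbtw x' y' z' := by
  have hx'yz : sbtw x' y z :=
    hA.sbtw_of_mem hx hx' (hAB.notMem_of_mem_right hy) (hDA.notMem_of_mem_left hz) h
  have hx'y'z : sbtw y' z x' := hB.sbtw_of_mem hy hy' (hBD.notMem_of_mem_right hz)
    (hAB.notMem_of_mem_left hx') hx'yz.cyclic_left
  exact (hD.sbtw_of_mem hz hz' (hDA.notMem_of_mem_right hx') (hBD.notMem_of_mem_left hy')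
    hx'y'z.cyclic_left).cyclic_left

end CircularOrder

section StrictCyclicMono

variable {ι C D : Type*} [CircularOrder ι] [CircularOrder C] [CircularOrder D] {f : ι → C}

/-- A map of circular orders that preserves the cyclic order of distinct points. -/
def StrictCyclicMono (f : ι → C) : Prop :=
  ∀ ⦃i j k⦄, sbtw i j k → sbtw (f i) (f j) (f k)

theorem StrictCyclicMono.comp {g : C → D} (hg : StrictCyclicMono g) (hf : StrictCyclicMono f) :
    StrictCyclicMono (g ∘ f) := fun _ _ _ h => hg (hf h)

theorem StrictCyclicMono.sbtw_iff (hf : StrictCyclicMono f) {i j k : ι} :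
    sbtw (f i) (f j) (f k) ↔ sbtw i j k := by
  refine ⟨fun h => ?_, fun h => hf h⟩
  have hij : i ≠ j := fun e => sbtw_irrefl_left (e ▸ h)
  have hjk : j ≠ k := fun e => sbtw_irrefl_right (e ▸ h)
  have hki : k ≠ i := fun e => sbtw_irrefl_left_right (e ▸ h)
  exact (sbtw_or_sbtw_swap hij hjk hki).resolve_right fun h' => sbtw_asymm h (hf h')

theorem StrictCyclicMono.isArc_preimage (hf : StrictCyclicMono f) {A : Set C} (hA : IsArc A) :
    IsArc (f ⁻¹' A) := fun _ hi _ hj =>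
  (hA _ hi _ hj).imp (fun h _ hk => h _ (hf hk)) fun h _ hk => h _ (hf hk)

theorem StrictCyclicMono.update [DecidableEq ι] (hf : StrictCyclicMono f) {A : Set C}
    (hA : IsArc A) {i : ι} (hi : f i ∈ A) (hne : ∀ j ≠ i, f j ∉ A) {z : C} (hz : z ∈ A) :
    StrictCyclicMono (Function.update f i z) := by
  set g := Function.update f i z
  have hself : g i = z := update_self i z f
  have hother {j : ι} (hj : j ≠ i) : g j = f j := update_of_ne hj z f
  have hmoved {j k : ι} (h : sbtw i j k) : sbtw (g i) (g j) (g k) := by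
    have hj : j ≠ i := fun e => sbtw_irrefl_left (e ▸ h)
    have hk : k ≠ i := fun e => sbtw_irrefl_left_right (e ▸ h)
    rw [hself, hother hj, hother hk]
    exact hA.sbtw_of_mem hi hz (hne j hj) (hne k hk) (hf h)
  intro j k l h
  by_cases hj : j = i
  · subst hj
    exact hmoved h
  by_cases hk : k = i
  · subst hk
    exact sbtw_cyclic_right (hmoved h.cyclic_left)
  by_cases hl : l = i
  · subst hl
    exact (hmoved (sbtw_cyclic_right h)).cyclic_left
  rw [hother hj, hother hk, hother hl]
  exact hf h

end StrictCyclicMono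

section Pattern

/-- The place of the over end of each arrow among the eight ends of the pattern `IsPattern`. -/
def overIndex : Fin 4 → Fin 8 := ![0, 2, 4, 6]

/-- The place of the under end of each arrow among the eight ends of the pattern `IsPattern`. -/
def underIndex : Fin 4 → Fin 8 := ![5, 7, 1, 3]

theorem overIndex_injective : Injective overIndex := by decide

theorem underIndex_injective : Injective underIndex := by decide

theorem overIndex_ne_underIndex : ∀ i j, overIndex i ≠ underIndex j := by decide

theorem exists_overIndex_eq_or_exists_underIndex_eq :
    ∀ m, (∃ i, overIndex i = m) ∨ ∃ i, underIndex i = m := by decide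

instance {n : ℕ} (i j k : Fin n) : Decidable (sbtw i j k) :=
  inferInstanceAs (Decidable (i < j ∧ j < k ∨ j < k ∧ k < i ∨ k < i ∧ i < j))

section Positions

variable {B : Set (Fin 8)} {i j : Fin 4}

theorem IsArc.exists_underIndex_mem (hB : IsArc B) (hij : i ≠ j) (hi : overIndex i ∈ B)
    (hj : overIndex j ∈ B) : ∃ k, underIndex k ∈ B := by
  have between : ∀ i j, i ≠ j → ∃ k, sbtw (overIndex i) (underIndex k) (overIndex j) := by decide
  obtain ⟨k, hk⟩ := between i j hij
  obtain ⟨l, hl⟩ := between j i hij.symm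
  exact (hB _ hi _ hj).elim (fun h => ⟨k, h _ hk⟩) fun h => ⟨l, h _ hl⟩

theorem IsArc.exists_overIndex_mem (hB : IsArc B) (hij : i ≠ j) (hi : underIndex i ∈ B)
    (hj : underIndex j ∈ B) : ∃ k, overIndex k ∈ B := by
  have between : ∀ i j, i ≠ j → ∃ k, sbtw (underIndex i) (overIndex k) (underIndex j) := by decide
  obtain ⟨k, hk⟩ := between i j hij
  obtain ⟨l, hl⟩ := between j i hij.symm
  exact (hB _ hi _ hj).elim (fun h => ⟨k, h _ hk⟩) fun h => ⟨l, h _ hl⟩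

theorem IsArc.exists_ne_overIndex_mem (hB : IsArc B) (hi : overIndex i ∈ B)
    (hi' : underIndex i ∈ B) : ∃ k ≠ i, overIndex k ∈ B := by
  have between : ∀ i, (∃ k ≠ i, sbtw (overIndex i) (overIndex k) (underIndex i)) ∧
      ∃ k ≠ i, sbtw (underIndex i) (overIndex k) (overIndex i) := by decide
  obtain ⟨⟨k, hki, hk⟩, l, hli, hl⟩ := between i
  exact (hB _ hi _ hi').elim (fun h => ⟨k, hki, h _ hk⟩) fun h => ⟨l, hli, h _ hl⟩

theorem IsArc.sbtw_overIndex_underIndex (hB : IsArc B) (hi : underIndex i ∈ B)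
    (hj : overIndex j ∈ B) (honly : ∀ m ∈ B, m = underIndex i ∨ m = overIndex j) :
    sbtw (overIndex i) (underIndex j) (underIndex i) := by
  have neighbours : ∀ i j, (∀ m, ¬ sbtw (underIndex i) m (overIndex j)) ∨
      (∀ m, ¬ sbtw (overIndex j) m (underIndex i)) →
      sbtw (overIndex i) (underIndex j) (underIndex i) := by decide
  have notMem {m k l : Fin 8} (h : sbtw k m l) (hkl : ∀ m ∈ B, m = k ∨ m = l) : m ∉ B := by
    intro hm
    rcases hkl m hm with rfl | rfl
    exacts [sbtw_irrefl_left h, sbtw_irrefl_right h]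
  refine neighbours i j ((hB _ hi _ hj).imp (fun h m hm => ?_) fun h m hm => ?_)
  · exact notMem hm honly (h m hm)
  · exact notMem hm (fun m hm => (honly m hm).symm) (h m hm)

end Positions

variable {C : Type*} [CircularOrder C] {A B : Set C} {c : Fin 4 → C × C} {i j : Fin 4}

/-- Four arrows whose ends are met in the cyclic order over 0, under 2, over 1, under 3, over 2,
under 0, over 3, under 1; an arrow is the pair of its over end and its under end. -/
def IsPattern (c : Fin 4 → C × C) : Prop :=
  ∃ x : Fin 8 → C, StrictCyclicMono x ∧ ∀ i, c i = (x (overIndex i), x (underIndex i))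

theorem IsPattern.injective (hc : IsPattern c) : Injective c := by
  obtain ⟨x, hx, hcx⟩ := hc
  have exists_sbtw : ∀ i j, i ≠ j → ∃ k, sbtw (overIndex i) k (overIndex j) := by decide
  intro i j h
  by_contra hij
  obtain ⟨k, hk⟩ := exists_sbtw i j hij
  have hfst : x (overIndex i) = x (overIndex j) := by
    simpa only [hcx] using congrArg Prod.fst h
  exact sbtw_irrefl_left_right (hfst ▸ hx hk)

theorem IsPattern.exists_snd_mem (hc : IsPattern c) (hA : IsArc A) (hij : i ≠ j)
    (hi : (c i).1 ∈ A) (hj : (c j).1 ∈ A) : ∃ k, (c k).2 ∈ A := by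
  obtain ⟨x, hx, hcx⟩ := hc
  simp only [hcx] at *
  exact (hx.isArc_preimage hA).exists_underIndex_mem hij hi hj

theorem IsPattern.exists_fst_mem (hc : IsPattern c) (hA : IsArc A) (hij : i ≠ j)
    (hi : (c i).2 ∈ A) (hj : (c j).2 ∈ A) : ∃ k, (c k).1 ∈ A := by
  obtain ⟨x, hx, hcx⟩ := hc
  simp only [hcx] at *
  exact (hx.isArc_preimage hA).exists_overIndex_mem hij hi hj

theorem IsPattern.exists_ne_fst_mem (hc : IsPattern c) (hA : IsArc A) (hi : c i ∈ A ×ˢ A) :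
    ∃ k ≠ i, (c k).1 ∈ A := by
  obtain ⟨x, hx, hcx⟩ := hc
  simp only [hcx, mem_prod] at *
  exact (hx.isArc_preimage hA).exists_ne_overIndex_mem hi.1 hi.2

theorem IsPattern.sbtw_fst_snd_snd (hc : IsPattern c) (hA : IsArc A) (hi : (c i).2 ∈ A)
    (hj : (c j).1 ∈ A) (hi' : ∀ k, (c k).2 ∈ A → k = i) (hj' : ∀ k, (c k).1 ∈ A → k = j) :
    sbtw (c i).1 (c j).2 (c i).2 := by
  obtain ⟨x, hx, hcx⟩ := hc
  simp only [hcx] at *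
  refine hx ((hx.isArc_preimage hA).sbtw_overIndex_underIndex hi hj fun m hm => ?_)
  rcases exists_overIndex_eq_or_exists_underIndex_eq m with ⟨k, rfl⟩ | ⟨k, rfl⟩
  · exact Or.inr (congrArg _ (hj' k hm))
  · exact Or.inl (congrArg _ (hi' k hm))

theorem IsPattern.update (hc : IsPattern c) (hA : IsArc A) (hB : IsArc B) (hAB : Disjoint A B)
    (hi : c i ∈ A ×ˢ B) (hne : ∀ j ≠ i, c j ∈ (A ∪ B)ᶜ ×ˢ (A ∪ B)ᶜ) {e : C × C}
    (he : e ∈ A ×ˢ B) : IsPattern (update c i e) := by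
  obtain ⟨x, hx, hcx⟩ := hc
  simp only [hcx, mem_prod, mem_compl_iff, mem_union, not_or] at hi hne
  have hxA : ∀ m ≠ overIndex i, x m ∉ A := by
    intro m hm
    rcases exists_overIndex_eq_or_exists_underIndex_eq m with ⟨k, rfl⟩ | ⟨k, rfl⟩
    · exact (hne k fun h => hm (congrArg _ h)).1.1
    · rcases eq_or_ne k i with rfl | hk
      exacts [hAB.notMem_of_mem_right hi.2, (hne k hk).2.1]
  have hxB : ∀ m ≠ underIndex i, Function.update x (overIndex i) e.1 m ∉ B := by
    intro m hm
    rcases eq_or_ne m (overIndex i) with rfl | hm'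
    · rw [update_self]
      exact hAB.notMem_of_mem_left he.1
    · rw [update_of_ne hm']
      rcases exists_overIndex_eq_or_exists_underIndex_eq m with ⟨k, rfl⟩ | ⟨k, rfl⟩
      · exact (hne k fun h => hm' (congrArg _ h)).1.2
      · exact (hne k fun h => hm (congrArg _ h)).2.2
  have hxi : Function.update x (overIndex i) e.1 (underIndex i) ∈ B := by
    rw [update_of_ne (overIndex_ne_underIndex i i).symm]
    exact hi.2
  refine ⟨_, (hx.update hA hi.1 hxA he.1).update hB hxi hxB he.2, fun k => ?_⟩
  rcases eq_or_ne k i with rfl | hk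
  · rw [update_self, update_self, update_of_ne (overIndex_ne_underIndex k k), update_self]
  · rw [update_of_ne hk, hcx, update_of_ne (overIndex_ne_underIndex k i),
      update_of_ne (overIndex_injective.ne hk), update_of_ne (underIndex_injective.ne hk),
      update_of_ne (overIndex_ne_underIndex i k).symm]

end Pattern

section PatternSets

variable {C ι : Type*} [CircularOrder C] {X Y O : Set (C × C)}

/-- The sets of four arrows of `X` that form the pattern. -/
def patternSets (X : Set (C × C)) : Set (Set (C × C)) :=
  {S | S ⊆ X ∧ ∃ c, IsPattern c ∧ range c = S}

theorem patternSets_mono (h : X ⊆ Y) : patternSets X ⊆ patternSets Y :=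
  fun _ hS => ⟨hS.1.trans h, hS.2⟩

theorem patternSets_union_pair {e e' : C × C}
    (h : ∀ c, IsPattern c → range c ⊆ O ∪ {e, e'} → e ∉ range c ∨ e' ∉ range c) :
    patternSets (O ∪ {e, e'}) = patternSets (O ∪ {e}) ∪ patternSets (O ∪ {e'}) := by
  refine Subset.antisymm ?_ (union_subset (patternSets_mono ?_) (patternSets_mono ?_))
  · rintro _ ⟨hS, c, hc, rfl⟩
    refine (h c hc hS).symm.imp (fun hne => ⟨fun z hz => ?_, c, hc, rfl⟩)
      fun hne => ⟨fun z hz => ?_, c, hc, rfl⟩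
    · exact (hS hz).imp_right fun hz' => hz'.resolve_right (ne_of_mem_of_not_mem hz hne)
    · exact (hS hz).imp_right fun hz' => hz'.resolve_left (ne_of_mem_of_not_mem hz hne)
  · exact union_subset_union_right O (singleton_subset_iff.mpr (mem_insert e _))
  · exact union_subset_union_right O (subset_insert e _)

theorem patternSets_inter (X Y : Set (C × C)) :
    patternSets X ∩ patternSets Y = patternSets (X ∩ Y) := by
  ext S
  exact ⟨fun h => ⟨subset_inter h.1.1 h.2.1, h.1.2⟩,
    fun h => ⟨⟨h.1.trans inter_subset_left, h.2⟩, h.1.trans inter_subset_right, h.2⟩⟩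

theorem finite_patternSets (hX : X.Finite) : (patternSets X).Finite :=
  hX.finite_subsets.subset fun _ hS => hS.1

theorem patternSets_range (g : ι → C × C) :
    patternSets (range g) = image g '' {S | ∃ c, IsPattern (g ∘ c) ∧ range c = S} := by
  ext S
  constructor
  · rintro ⟨hS, c, hc, rfl⟩
    obtain ⟨c, rfl⟩ : ∃ c', g ∘ c' = c := ⟨_, funext fun i => (hS ⟨i, rfl⟩).choose_spec⟩
    exact ⟨_, ⟨c, hc, rfl⟩, (range_comp g c).symm⟩
  · rintro ⟨_, ⟨c, hc, rfl⟩, rfl⟩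
    exact ⟨image_subset_range g _, g ∘ c, hc, range_comp g c⟩

theorem IsPattern.patternSets_range {c : Fin 4 → C × C} (hc : IsPattern c) :
    patternSets (range c) = {range c} := by
  refine Subset.antisymm ?_ (singleton_subset_iff.mpr ⟨Subset.rfl, c, hc, rfl⟩)
  rintro _ ⟨hsub, c', hc', rfl⟩
  refine eq_of_subset_of_ncard_le hsub ?_ (finite_range c)
  rw [ncard_range_of_injective hc.injective, ncard_range_of_injective hc'.injective]

theorem ncard_patternSets_range_congr {D : Type*} [CircularOrder D] {g : ι → C × C}
    {h : ι → D × D} (hg : Injective g) (hh : Injective h)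
    (hgh : ∀ c, IsPattern (g ∘ c) ↔ IsPattern (h ∘ c)) :
    (patternSets (range g)).ncard = (patternSets (range h)).ncard := by
  rw [patternSets_range, patternSets_range, ncard_image_of_injective _ hg.image_injective,
    ncard_image_of_injective _ hh.image_injective]
  simp only [hgh]

/-- Two sets of arrows are both infinite, or both are finite and their numbers of patterns have
the same parity. -/
def SameParity (X Y : Set (C × C)) : Prop :=
  (X.Finite ↔ Y.Finite) ∧
    (X.Finite → (patternSets X).ncard ≡ (patternSets Y).ncard [MOD 2])

theorem SameParity.refl (X : Set (C × C)) : SameParity X X := ⟨Iff.rfl, fun _ => rfl⟩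

theorem SameParity.symm (h : SameParity X Y) : SameParity Y X :=
  ⟨h.1.symm, fun hY => (h.2 (h.1.mpr hY)).symm⟩

theorem SameParity.trans {Z : Set (C × C)} (h : SameParity X Y) (h' : SameParity Y Z) :
    SameParity X Z :=
  ⟨h.1.trans h'.1, fun hX => (h.2 hX).trans (h'.2 (h.1.mp hX))⟩

theorem sameParity_union (hX : X.Finite) (hY : Y.Finite)
    (h : O.Finite → (patternSets (O ∪ X)).ncard ≡ (patternSets (O ∪ Y)).ncard [MOD 2]) :
    SameParity (O ∪ X) (O ∪ Y) := by
  simp only [SameParity, finite_union, hX, hY, and_true, true_and]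
  exact h

end PatternSets

section ForwardArrows

variable {C κ : Type*} [Preorder κ] {A : κ → Set C} {O : Set (C × C)} {e : C × C} {p : κ}

/-- The arrows that lead from one of the arcs `A k` to a later one. -/
def forwardArrows (A : κ → Set C) : Set (C × C) :=
  {e | ∃ p q, p < q ∧ e ∈ A p ×ˢ A q}

theorem exists_snd_mem_of_fst_mem (hdisj : Pairwise (Disjoint on A))
    (hO : O ⊆ (⋃ k, A k)ᶜ ×ˢ (⋃ k, A k)ᶜ) (he : e ∈ O ∪ forwardArrows A) (hp : e.1 ∈ A p) :
    ∃ q > p, e.2 ∈ A q := by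
  rcases he with he | ⟨p', q, hpq, he⟩
  · exact absurd (mem_iUnion_of_mem p hp) (hO he).1
  · obtain rfl : p = p' := hdisj.eq (not_disjoint_iff.mpr ⟨_, hp, he.1⟩)
    exact ⟨q, hpq, he.2⟩

theorem exists_fst_mem_of_snd_mem (hdisj : Pairwise (Disjoint on A))
    (hO : O ⊆ (⋃ k, A k)ᶜ ×ˢ (⋃ k, A k)ᶜ) (he : e ∈ O ∪ forwardArrows A) (hp : e.2 ∈ A p) :
    ∃ q < p, e.1 ∈ A q := by
  rcases he with he | ⟨q, p', hqp, he⟩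
  · exact absurd (mem_iUnion_of_mem p hp) (hO he).2
  · obtain rfl : p = p' := hdisj.eq (not_disjoint_iff.mpr ⟨_, hp, he.2⟩)
    exact ⟨q, hqp, he.1⟩

theorem injective_sumElim_arrows (hdisj : Pairwise (Disjoint on A))
    (hO : O ⊆ (⋃ k, A k)ᶜ ×ˢ (⋃ k, A k)ᶜ) {e : {p : κ × κ // p.1 < p.2} → C × C}
    (he : ∀ p, e p ∈ A p.1.1 ×ˢ A p.1.2) :
    Injective (Sum.elim ((↑) : O → C × C) e) := by
  refine Subtype.val_injective.sumElim (fun p q h => ?_) fun o p h => ?_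
  · refine Subtype.ext (Prod.ext (hdisj.eq ?_) (hdisj.eq ?_))
    · exact not_disjoint_iff.mpr ⟨_, (he p).1, h ▸ (he q).1⟩
    · exact not_disjoint_iff.mpr ⟨_, (he p).2, h ▸ (he q).2⟩
  · exact (hO o.2).1 (mem_iUnion_of_mem _ (h ▸ (he p).1))

end ForwardArrows

section Exchange

variable {C κ : Type*} [CircularOrder C] {A : κ → Set C} {O : Set (C × C)}

theorem sameParity_union_singleton {A : Set C} (hA : IsArc A) (hO : O ⊆ Aᶜ ×ˢ Aᶜ) {e : C × C}
    (he : e ∈ A ×ˢ A) : SameParity O (O ∪ {e}) := by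
  have hsets : patternSets (O ∪ {e}) = patternSets O := by
    refine Subset.antisymm ?_ (patternSets_mono subset_union_left)
    rintro _ ⟨hS, c, hc, rfl⟩
    refine ⟨?_, c, hc, rfl⟩
    rintro _ ⟨i, rfl⟩
    refine (hS ⟨i, rfl⟩).resolve_right fun hi => ?_
    obtain ⟨k, hki, hk⟩ := hc.exists_ne_fst_mem hA ((mem_singleton_iff.mp hi) ▸ he)
    rcases hS ⟨k, rfl⟩ with h | h
    · exact (hO h).1 hk
    · exact hki (hc.injective (h.trans hi.symm))
  have := sameParity_union finite_empty (finite_singleton e) (O := O) fun _ => by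
    rw [union_empty, hsets]
  rwa [union_empty] at this

variable [Preorder κ]

section AtMostOne

variable {c : Fin 4 → C × C} {i j : Fin 4} {p : κ}

theorem IsPattern.eq_of_fst_mem_of_isMin (hc : IsPattern c) (hA : ∀ k, IsArc (A k))
    (hdisj : Pairwise (Disjoint on A)) (hO : O ⊆ (⋃ k, A k)ᶜ ×ˢ (⋃ k, A k)ᶜ)
    (hsub : range c ⊆ O ∪ forwardArrows A) (hp : IsMin p) (hi : (c i).1 ∈ A p)
    (hj : (c j).1 ∈ A p) : i = j := by
  by_contra hij
  obtain ⟨k, hk⟩ := hc.exists_snd_mem (hA p) hij hi hj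
  obtain ⟨q, hqp, -⟩ := exists_fst_mem_of_snd_mem hdisj hO (hsub ⟨k, rfl⟩) hk
  exact hp.not_lt hqp

theorem IsPattern.eq_of_snd_mem_of_isMax (hc : IsPattern c) (hA : ∀ k, IsArc (A k))
    (hdisj : Pairwise (Disjoint on A)) (hO : O ⊆ (⋃ k, A k)ᶜ ×ˢ (⋃ k, A k)ᶜ)
    (hsub : range c ⊆ O ∪ forwardArrows A) (hp : IsMax p) (hi : (c i).2 ∈ A p)
    (hj : (c j).2 ∈ A p) : i = j := by
  by_contra hij
  obtain ⟨k, hk⟩ := hc.exists_fst_mem (hA p) hij hi hj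
  obtain ⟨q, hpq, -⟩ := exists_snd_mem_of_fst_mem hdisj hO (hsub ⟨k, rfl⟩) hk
  exact hp.not_lt hpq

/-- No pattern made of arrows of `O` and of forward arrows contains two forward arrows. -/
def AtMostOneForward (A : κ → Set C) (O : Set (C × C)) : Prop :=
  ∀ c, IsPattern c → range c ⊆ O ∪ forwardArrows A →
    ∀ i j, c i ∈ forwardArrows A → c j ∈ forwardArrows A → i = j

theorem atMostOneForward_two {A : Fin 2 → Set C} (hA : ∀ k, IsArc (A k))
    (hdisj : Pairwise (Disjoint on A)) (hO : O ⊆ (⋃ k, A k)ᶜ ×ˢ (⋃ k, A k)ᶜ) :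
    AtMostOneForward A O := by
  rintro c hc hsub i j ⟨p, q, hpq, hi⟩ ⟨p', q', hpq', hj⟩
  obtain rfl : p = 0 := by lia
  obtain rfl : p' = 0 := by lia
  exact hc.eq_of_fst_mem_of_isMin hA hdisj hO hsub isMin_bot hi.1 hj.1

theorem atMostOneForward_three {A : Fin 3 → Set C} (hA : ∀ k, IsArc (A k))
    (hdisj : Pairwise (Disjoint on A)) (hO : O ⊆ (⋃ k, A k)ᶜ ×ˢ (⋃ k, A k)ᶜ)
    (hcyc : ∀ x ∈ A 0, ∀ y ∈ A 1, ∀ z ∈ A 2, sbtw x y z) : AtMostOneForward A O := by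
  intro c hc hsub
  have eq_of_fst {i j} : (c i).1 ∈ A 0 → (c j).1 ∈ A 0 → i = j :=
    hc.eq_of_fst_mem_of_isMin hA hdisj hO hsub isMin_bot
  have eq_of_snd {i j} : (c i).2 ∈ A 2 → (c j).2 ∈ A 2 → i = j :=
    hc.eq_of_snd_mem_of_isMax hA hdisj hO hsub isMax_top
  -- The ends in the middle arc would be neighbours in the pattern, which then visits the arcs in
  -- the wrong cyclic order.
  have not_both {i j} (hi : c i ∈ A 0 ×ˢ A 1) (hj : c j ∈ A 1 ×ˢ A 2) : False := by
    refine sbtw_asymm (hcyc _ hi.1 _ hi.2 _ hj.2)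
      (hc.sbtw_fst_snd_snd (hA 1) hi.2 hj.1 (fun k hk => ?_) fun k hk => ?_).cyclic_left
    · obtain ⟨q, hq, hkq⟩ := exists_fst_mem_of_snd_mem hdisj hO (hsub ⟨k, rfl⟩) hk
      obtain rfl : q = 0 := by lia
      exact eq_of_fst hkq hi.1
    · obtain ⟨q, hq, hkq⟩ := exists_snd_mem_of_fst_mem hdisj hO (hsub ⟨k, rfl⟩) hk
      obtain rfl : q = 2 := by lia
      exact eq_of_snd hkq hj.2
  rintro i j ⟨p, q, hpq, hi⟩ ⟨p', q', hpq', hj⟩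
  by_cases hp : p = 0
  · by_cases hp' : p' = 0
    · exact eq_of_fst (hp ▸ hi.1) (hp' ▸ hj.1)
    · obtain ⟨rfl, rfl⟩ : p' = 1 ∧ q' = 2 := by lia
      obtain ⟨rfl, rfl | rfl⟩ : p = 0 ∧ (q = 1 ∨ q = 2) := by lia
      exacts [(not_both hi hj).elim, eq_of_snd hi.2 hj.2]
  · obtain ⟨rfl, rfl⟩ : p = 1 ∧ q = 2 := by lia
    obtain rfl | ⟨rfl, rfl⟩ : q' = 2 ∨ p' = 0 ∧ q' = 1 := by lia
    exacts [eq_of_snd hi.2 hj.2, (not_both hj hi).elim]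

end AtMostOne

variable {e e' : {p : κ × κ // p.1 < p.2} → C × C}

theorem IsPattern.exchange (hA : ∀ k, IsArc (A k)) (hdisj : Pairwise (Disjoint on A))
    (hO : O ⊆ (⋃ k, A k)ᶜ ×ˢ (⋃ k, A k)ᶜ) (hone : AtMostOneForward A O)
    (he : ∀ p, e p ∈ A p.1.1 ×ˢ A p.1.2) (he' : ∀ p, e' p ∈ A p.1.1 ×ˢ A p.1.2)
    {c : Fin 4 → O ⊕ {p : κ × κ // p.1 < p.2}} (hc : IsPattern (Sum.elim (↑) e ∘ c)) :
    IsPattern (Sum.elim (↑) e' ∘ c) := by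
  have hforward (p) : e p ∈ forwardArrows A := ⟨_, _, p.2, he p⟩
  have hsub : range (Sum.elim (↑) e ∘ c) ⊆ O ∪ forwardArrows A := by
    rintro _ ⟨i, rfl⟩
    rcases hi : c i with o | p
    · exact Or.inl (by simp [hi])
    · exact Or.inr (by simp [hi, hforward p])
  by_cases hall : ∃ i p, c i = Sum.inr p
  · obtain ⟨i, p, hi⟩ := hall
    have hinl (j) (hj : j ≠ i) : ∃ o, c j = Sum.inl o := by
      rcases hcj : c j with o | q
      · exact ⟨o, rfl⟩
      · exact absurd (hone _ hc hsub j i (by simp [hcj, hforward q]) (by simp [hi, hforward p])) hj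
    have hupdate : Sum.elim (↑) e' ∘ c = Function.update (Sum.elim (↑) e ∘ c) i (e' p) := by
      refine eq_update_iff.mpr ⟨by simp [hi], fun j hj => ?_⟩
      obtain ⟨o, ho⟩ := hinl j hj
      simp [ho]
    rw [hupdate]
    refine hc.update (hA p.1.1) (hA p.1.2) (hdisj p.2.ne) (by simpa [hi] using he p)
      (fun j hj => ?_) (he' p)
    obtain ⟨o, ho⟩ := hinl j hj
    have hout : (A p.1.1 ∪ A p.1.2) ⊆ ⋃ k, A k :=
      union_subset (subset_iUnion A _) (subset_iUnion A _)
    simpa only [comp_apply, ho, Sum.elim_inl] using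
      prod_mono (compl_subset_compl.mpr hout) (compl_subset_compl.mpr hout) (hO o.2)
  · have heq : Sum.elim (↑) e ∘ c = Sum.elim (↑) e' ∘ c := by
      funext i
      rcases hi : c i with o | p
      · simp [hi]
      · exact absurd ⟨i, p, hi⟩ hall
    rwa [← heq]

theorem ncard_patternSets_exchange (hA : ∀ k, IsArc (A k)) (hdisj : Pairwise (Disjoint on A))
    (hO : O ⊆ (⋃ k, A k)ᶜ ×ˢ (⋃ k, A k)ᶜ) (hone : AtMostOneForward A O)
    (he : ∀ p, e p ∈ A p.1.1 ×ˢ A p.1.2) (he' : ∀ p, e' p ∈ A p.1.1 ×ˢ A p.1.2) :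
    (patternSets (O ∪ range e)).ncard = (patternSets (O ∪ range e')).ncard := by
  have hrange (e : {p : κ × κ // p.1 < p.2} → C × C) :
      O ∪ range e = range (Sum.elim ((↑) : O → C × C) e) := by
    rw [Sum.elim_range, Subtype.range_coe]
  rw [hrange, hrange]
  exact ncard_patternSets_range_congr (injective_sumElim_arrows hdisj hO he)
    (injective_sumElim_arrows hdisj hO he') fun c =>
      ⟨.exchange hA hdisj hO hone he he', .exchange hA hdisj hO hone he' he⟩

theorem sameParity_union_triangle {A : Fin 3 → Set C} (hA : ∀ k, IsArc (A k))
    (hdisj : Pairwise (Disjoint on A)) (hO : O ⊆ (⋃ k, A k)ᶜ ×ˢ (⋃ k, A k)ᶜ)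
    (hcyc : ∀ x ∈ A 0, ∀ y ∈ A 1, ∀ z ∈ A 2, sbtw x y z)
    {e e' : {p : Fin 3 × Fin 3 // p.1 < p.2} → C × C}
    (he : ∀ p, e p ∈ A p.1.1 ×ˢ A p.1.2) (he' : ∀ p, e' p ∈ A p.1.1 ×ˢ A p.1.2) :
    SameParity (O ∪ range e) (O ∪ range e') := by
  refine sameParity_union (finite_range e) (finite_range e') fun _ => ?_
  rw [ncard_patternSets_exchange hA hdisj hO
    (atMostOneForward_three hA hdisj hO hcyc) he he']

theorem sameParity_union_pair {A : Fin 2 → Set C} (hA : ∀ k, IsArc (A k))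
    (hdisj : Pairwise (Disjoint on A)) (hO : O ⊆ (⋃ k, A k)ᶜ ×ˢ (⋃ k, A k)ᶜ) {e e' : C × C}
    (hne : e ≠ e') (he : e ∈ A 0 ×ˢ A 1) (he' : e' ∈ A 0 ×ˢ A 1) :
    SameParity O (O ∪ {e, e'}) := by
  have hone : AtMostOneForward A O := atMostOneForward_two hA hdisj hO
  have hforward {z : C × C} (hz : z ∈ A 0 ×ˢ A 1) : z ∈ forwardArrows A :=
    ⟨0, 1, by decide, hz⟩
  have hcongr : (patternSets (O ∪ {e})).ncard = (patternSets (O ∪ {e'})).ncard := by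
    have hpair (p : {p : Fin 2 × Fin 2 // p.1 < p.2}) : p.1.1 = 0 ∧ p.1.2 = 1 := by lia
    have : Nonempty {p : Fin 2 × Fin 2 // p.1 < p.2} := ⟨(0, 1), by decide⟩
    simpa only [range_const] using ncard_patternSets_exchange hA hdisj hO hone
      (e := fun _ => e) (e' := fun _ => e') (fun p => by rwa [(hpair p).1, (hpair p).2])
      fun p => by rwa [(hpair p).1, (hpair p).2]
  have hunion : patternSets (O ∪ {e, e'}) = patternSets (O ∪ {e}) ∪ patternSets (O ∪ {e'}) := by
    refine patternSets_union_pair fun c hc hsub => ?_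
    by_contra! h
    obtain ⟨⟨i, rfl⟩, j, rfl⟩ := h
    refine hne (congrArg c (hone c hc (hsub.trans (union_subset_union_right O ?_)) i j
      (hforward he) (hforward he')))
    exact pair_subset (hforward he) (hforward he')
  have hinter : patternSets (O ∪ {e}) ∩ patternSets (O ∪ {e'}) = patternSets O := by
    rw [patternSets_inter, ← union_inter_distrib_left,
      singleton_inter_eq_empty.mpr (notMem_singleton_iff.mpr hne), union_empty]
  have := sameParity_union finite_empty (toFinite {e, e'}) (O := O) fun hfin => by
    have hcard := ncard_union_add_ncard_inter (patternSets (O ∪ {e})) (patternSets (O ∪ {e'}))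
      (finite_patternSets (hfin.union (finite_singleton _)))
      (finite_patternSets (hfin.union (finite_singleton _)))
    rw [← hunion, hinter, hcongr] at hcard
    rw [union_empty, Nat.ModEq]
    lia
  rwa [union_empty] at this

end Exchange

section Map

variable {C : Type*} [CircularOrder C] {τ : C → C}

theorem isPattern_prodMap_comp_iff (hτ : StrictCyclicMono τ) (hinj : Injective τ)
    {c : Fin 4 → C × C} : IsPattern (Prod.map τ τ ∘ c) ↔ IsPattern c := by
  constructor
  · rintro ⟨x, hx, hcx⟩
    have hfst (i) : τ (c i).1 = x (overIndex i) := congrArg Prod.fst (hcx i)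
    have hsnd (i) : τ (c i).2 = x (underIndex i) := congrArg Prod.snd (hcx i)
    have hlift (m) : ∃ y, τ y = x m := by
      rcases exists_overIndex_eq_or_exists_underIndex_eq m with ⟨i, rfl⟩ | ⟨i, rfl⟩
      exacts [⟨_, hfst i⟩, ⟨_, hsnd i⟩]
    choose y hy using hlift
    obtain rfl : τ ∘ y = x := funext hy
    exact ⟨y, fun i j k h => hτ.sbtw_iff.mp (hx h),
      fun i => Prod.ext (hinj (hfst i)) (hinj (hsnd i))⟩
  · rintro ⟨x, hx, hcx⟩
    exact ⟨τ ∘ x, hτ.comp hx, fun i => congrArg (Prod.map τ τ) (hcx i)⟩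

theorem sameParity_image_prodMap (hτ : StrictCyclicMono τ) (hinj : Injective τ)
    (X : Set (C × C)) : SameParity X (Prod.map τ τ '' X) := by
  have hmap : Injective (Prod.map τ τ) := hinj.prodMap hinj
  refine ⟨(finite_image_iff hmap.injOn).symm, fun _ => ?_⟩
  have := ncard_patternSets_range_congr (g := ((↑) : X → C × C)) (h := Prod.map τ τ ∘ (↑))
    Subtype.val_injective (hmap.comp Subtype.val_injective)
    fun c => (isPattern_prodMap_comp_iff hτ hinj).symm
  rw [range_comp, Subtype.range_coe] at this
  rw [this]

end Map

section Circle

theorem sameParam_iff {s t : ℝ} : SameParam s t ↔ (s : UnitAddCircle) = t := by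
  rw [eq_comm, ← sub_eq_zero, ← AddCircle.coe_sub, AddCircle.coe_eq_zero_iff]
  refine exists_congr fun n => ?_
  rw [zsmul_eq_mul, mul_one, eq_sub_iff_add_eq', eq_comm]

theorem inCyclicOrder_iff_sbtw {x y z : ℝ} :
    InCyclicOrder x y z ↔ sbtw (x : UnitAddCircle) y z := by
  rw [sbtw_iff_not_btw, btw_cyclic, QuotientAddGroup.btw_coe_iff, not_le]
  constructor
  · rintro ⟨p, q, hxy, hyz, hzx⟩
    have hy : toIocMod one_pos x y = y + p :=
      (toIocMod_eq_iff one_pos).mpr ⟨⟨hxy, by linarith⟩, -p, by simp⟩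
    have hz : toIcoMod one_pos x z = z + q :=
      (toIcoMod_eq_iff one_pos).mpr ⟨⟨by linarith, hzx⟩, -q, by simp⟩
    rwa [hy, hz]
  · intro h
    have hy : y + (-toIocDiv one_pos x y : ℤ) = toIocMod one_pos x y := by
      simp [toIocMod, sub_eq_add_neg]
    have hz : z + (-toIcoDiv one_pos x z : ℤ) = toIcoMod one_pos x z := by
      simp [toIcoMod, sub_eq_add_neg]
    exact ⟨_, _, by rw [hy]; exact left_lt_toIocMod one_pos x y, by rwa [hy, hz],
      by rw [hz]; exact toIcoMod_lt_right one_pos x z⟩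

theorem inCyclicOrder_neg_iff {x y z : ℝ} :
    InCyclicOrder (-x) (-y) (-z) ↔ InCyclicOrder z y x := by
  have neg {x y z : ℝ} : InCyclicOrder x y z → InCyclicOrder (-z) (-y) (-x) := by
    rintro ⟨p, q, hxy, hyz, hzx⟩
    exact ⟨q - p, q, by push_cast; linarith, by push_cast; linarith, by linarith⟩
  exact ⟨fun h => by simpa only [neg_neg] using neg h, neg⟩

/-- The image of the interval `[α, β]` on the circle. -/
def arc (α β : ℝ) : Set UnitAddCircle := (↑) '' Icc α β

theorem isArc_arc (α β : ℝ) : IsArc (arc α β) := by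
  have between {u v : ℝ} (hu : u ∈ Icc α β) (hv : v ∈ Icc α β) (huv : u ≤ v) (z : UnitAddCircle)
      (hz : sbtw (u : UnitAddCircle) z v) : z ∈ arc α β := by
    induction z using QuotientAddGroup.induction_on with | H w
    obtain ⟨p, q, huw, hwv, hvu⟩ := inCyclicOrder_iff_sbtw.mpr hz
    have hq : (q : ℝ) ≤ 0 := by
      have : q < 1 := by exact_mod_cast (by linarith : (q : ℝ) < 1)
      exact_mod_cast (by lia : q ≤ 0)
    exact ⟨w + p, ⟨by linarith [hu.1], by linarith [hv.2]⟩, by simp⟩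
  rintro _ ⟨u, hu, rfl⟩ _ ⟨v, hv, rfl⟩
  exact (le_total u v).imp (between hu hv) (between hv hu)

theorem strictCyclicMono_coe_comp {n : ℕ} {t : Fin n → ℝ} (ht : StrictMono t)
    (hlt : ∀ i j, t i < t j + 1) : StrictCyclicMono fun i => (t i : UnitAddCircle) := by
  have ordered {i j k : Fin n} (hij : i < j) (hjk : j < k) :
      sbtw (t i : UnitAddCircle) (t j) (t k) :=
    inCyclicOrder_iff_sbtw.mp
      ⟨0, 0, by simpa using ht hij, by simpa using ht hjk, by simpa using hlt k i⟩
  rintro i j k (⟨hij, hjk⟩ | ⟨hjk, hki⟩ | ⟨hki, hij⟩)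
  · exact ordered hij hjk
  · exact sbtw_cyclic_right (ordered hjk hki)
  · exact (ordered hki hij).cyclic_left

end Circle

section Arrows

variable {K L : KnotDiagram} {s t : ℝ}

theorem KnotDiagram.γ_eq_of_coe_eq (K : KnotDiagram) (h : (s : UnitAddCircle) = t) :
    K.γ s = K.γ t := by
  obtain ⟨n, rfl⟩ := sameParam_iff.mpr h
  simpa using ((show Periodic K.γ 1 from K.periodic).int_mul n s).symm

theorem KnotDiagram.mem_overpass_of_coe_eq (K : KnotDiagram) (h : (s : UnitAddCircle) = t) :
    s ∈ K.overpass ↔ t ∈ K.overpass := by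
  obtain ⟨n, rfl⟩ := sameParam_iff.mpr h
  have hper : Periodic (fun x => x ∈ K.overpass) 1 := fun x => propext (K.overpass_periodic x)
  simpa using (hper.int_mul n s).symm

theorem crosses_iff : Crosses K.γ s t ↔ K.γ s = K.γ t ∧ (s : UnitAddCircle) ≠ t :=
  and_congr_right' (not_congr sameParam_iff)

/-- The arrows of the Gauss diagram of `K`, from the overpass to the underpass of each crossing. -/
def arrows (K : KnotDiagram) : Set (UnitAddCircle × UnitAddCircle) :=
  {p | ∃ s t : ℝ, Crosses K.γ s t ∧ s ∈ K.overpass ∧ p = (↑s, ↑t)}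

theorem coe_mem_arrows_iff :
    ((s : UnitAddCircle), (t : UnitAddCircle)) ∈ arrows K ↔
      (K.γ s = K.γ t ∧ (s : UnitAddCircle) ≠ t) ∧ s ∈ K.overpass := by
  rw [← crosses_iff]
  refine ⟨?_, fun h => ⟨s, t, h.1, h.2, rfl⟩⟩
  rintro ⟨s', t', hcross, hover, h⟩
  obtain ⟨hs, ht⟩ := Prod.mk.inj h
  rw [crosses_iff, ← hs, ← ht, ← K.γ_eq_of_coe_eq hs, ← K.γ_eq_of_coe_eq ht,
    ← crosses_iff] at hcross
  exact ⟨hcross, (K.mem_overpass_of_coe_eq hs).mpr hover⟩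

theorem swap_mem_arrows_iff (h : K.γ s = K.γ t ∧ (s : UnitAddCircle) ≠ t) :
    ((t : UnitAddCircle), (s : UnitAddCircle)) ∈ arrows K ↔
      ((s : UnitAddCircle), (t : UnitAddCircle)) ∉ arrows K := by
  have hover := K.overpass_iff s t (crosses_iff.mpr h)
  rw [coe_mem_arrows_iff, coe_mem_arrows_iff, and_iff_right h,
    and_iff_right ⟨h.1.symm, h.2.symm⟩, hover, not_not]

end Arrows

section Reparametrization

variable {σ : ℝ → ℝ} {K L : KnotDiagram}

theorem IsCircleDiffeo.strictMono (hσ : IsCircleDiffeo σ) : StrictMono σ :=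
  strictMono_of_deriv_pos hσ.2.2

theorem IsCircleDiffeo.add_int (hσ : IsCircleDiffeo σ) (t : ℝ) (n : ℤ) : σ (t + n) = σ t + n := by
  have hper : Periodic (fun x => σ x - x) 1 := fun x => by
    linarith [hσ.2.1 x]
  have hn := hper.int_mul n t
  simp only [mul_one] at hn
  linarith

theorem IsCircleDiffeo.surjective (hσ : IsCircleDiffeo σ) : Surjective σ := by
  intro y
  have hint (n : ℤ) : σ n = σ 0 + n := by simpa using hσ.add_int 0 n
  refine mem_range_of_exists_le_of_exists_ge hσ.1.continuous ⟨⌊y - σ 0⌋, ?_⟩ ⟨⌈y - σ 0⌉, ?_⟩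
  · rw [hint]
    linarith [Int.floor_le (y - σ 0)]
  · rw [hint]
    linarith [Int.le_ceil (y - σ 0)]

theorem IsCircleDiffeo.coe_eq_iff (hσ : IsCircleDiffeo σ) {s t : ℝ} :
    (σ s : UnitAddCircle) = σ t ↔ (s : UnitAddCircle) = t := by
  rw [← sameParam_iff, ← sameParam_iff]
  refine exists_congr fun n => ?_
  rw [← hσ.add_int, hσ.strictMono.injective.eq_iff]

theorem IsCircleDiffeo.inCyclicOrder (hσ : IsCircleDiffeo σ) {x y z : ℝ}
    (h : InCyclicOrder x y z) : InCyclicOrder (σ x) (σ y) (σ z) := by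
  obtain ⟨p, q, hxy, hyz, hzx⟩ := h
  refine ⟨p, q, ?_, ?_, ?_⟩
  · simpa only [hσ.add_int] using hσ.strictMono hxy
  · simpa only [hσ.add_int] using hσ.strictMono hyz
  · simpa only [hσ.add_int, hσ.2.1] using hσ.strictMono hzx

theorem IsCircleDiffeo.exists_lift (hσ : IsCircleDiffeo σ) :
    ∃ τ : UnitAddCircle → UnitAddCircle,
      StrictCyclicMono τ ∧ Injective τ ∧ ∀ t : ℝ, τ t = σ t := by
  have hper : Periodic (fun t => (σ t : UnitAddCircle)) 1 := fun t =>
    hσ.coe_eq_iff.mpr (by simp)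
  refine ⟨hper.lift, fun x y z h => ?_, fun x y h => ?_, fun _ => rfl⟩
  · induction x using QuotientAddGroup.induction_on
    induction y using QuotientAddGroup.induction_on
    induction z using QuotientAddGroup.induction_on
    exact inCyclicOrder_iff_sbtw.mp (hσ.inCyclicOrder (inCyclicOrder_iff_sbtw.mpr h))
  · induction x using QuotientAddGroup.induction_on
    induction y using QuotientAddGroup.induction_on
    exact hσ.coe_eq_iff.mp h

theorem sameParity_arrows_of_reparametrization {F : Plane → Plane} (hF : Injective F)
    (hσ : IsCircleDiffeo σ)
    (h : ∀ t, L.γ t = F (K.γ (σ t)) ∧ (t ∈ L.overpass ↔ σ t ∈ K.overpass)) :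
    SameParity (arrows K) (arrows L) := by
  obtain ⟨τ, hτ, hinj, hτσ⟩ := hσ.exists_lift
  have hmem (s t : ℝ) : ((σ s : UnitAddCircle), (σ t : UnitAddCircle)) ∈ arrows K ↔
      ((s : UnitAddCircle), (t : UnitAddCircle)) ∈ arrows L := by
    simp only [coe_mem_arrows_iff, ne_eq, hσ.coe_eq_iff, (h s).1, (h t).1, hF.eq_iff, (h s).2]
  have harrows : arrows K = Prod.map τ τ '' arrows L := by
    ext ⟨x, y⟩
    constructor
    · induction x using QuotientAddGroup.induction_on with | H s
      induction y using QuotientAddGroup.induction_on with | H t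
      obtain ⟨s, rfl⟩ := hσ.surjective s
      obtain ⟨t, rfl⟩ := hσ.surjective t
      exact fun hst => ⟨(↑s, ↑t), (hmem s t).mp hst, Prod.ext (hτσ s) (hτσ t)⟩
    · rintro ⟨_, ⟨s, t, hcross, hover, rfl⟩, hst⟩
      rw [← hst, Prod.map_apply, hτσ, hτσ, hmem]
      exact ⟨s, t, hcross, hover, rfl⟩
  rw [harrows]
  exact (sameParity_image_prodMap hτ hinj _).symm

theorem KnotDiagram.Equivalent.sameParity (h : K.Equivalent L) :
    SameParity (arrows K) (arrows L) := by
  obtain ⟨F, ⟨-, ⟨G, -, hG, -⟩, -⟩, σ, hσ, h⟩ := h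
  exact sameParity_arrows_of_reparametrization (LeftInverse.injective hG) hσ h

theorem KnotDiagram.Same.sameParity (h : K.Same L) : SameParity (arrows K) (arrows L) := by
  obtain ⟨σ, hσ, h⟩ := h
  exact sameParity_arrows_of_reparametrization (F := id) injective_id hσ h

end Reparametrization

section Moves

variable {n : ℕ} {m m' : Fin n → ℝ → Plane} {ord : Equiv.Perm (Fin n)} {a b : Fin n → ℝ}
  {K L : KnotDiagram} {φ : Plane → Plane}

theorem ArcsDisjoint.pairwise_disjoint (h : ArcsDisjoint a b) :
    Pairwise (Disjoint on fun i => arc (a i) (b i)) := by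
  intro i j hij
  refine Set.disjoint_left.mpr ?_
  rintro _ ⟨s, hs, rfl⟩ ⟨t, ht, hst⟩
  exact hij (h i j s hs t ht (sameParam_iff.mpr hst.symm)).1

theorem coe_mem_iUnion_arc_iff {t : ℝ} :
    (t : UnitAddCircle) ∈ ⋃ i, arc (a i) (b i) ↔ InArcs a b t := by
  simp only [mem_iUnion, arc, mem_image, InArcs, sameParam_iff]

/-- The arrows of `K` with both ends outside the arcs `[a i, b i]`. -/
def outerArrows (K : KnotDiagram) (a b : Fin n → ℝ) : Set (UnitAddCircle × UnitAddCircle) :=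
  arrows K ∩ (⋃ i, arc (a i) (b i))ᶜ ×ˢ (⋃ i, arc (a i) (b i))ᶜ

theorem outerArrows_congr
    (h : ∀ t, ¬ InArcs a b t → K.γ t = L.γ t ∧ (t ∈ K.overpass ↔ t ∈ L.overpass)) :
    outerArrows K a b = outerArrows L a b := by
  ext ⟨x, y⟩
  refine and_congr_left fun ⟨hx, hy⟩ => ?_
  induction x using QuotientAddGroup.induction_on with | H s
  induction y using QuotientAddGroup.induction_on with | H t
  have hs := h s (coe_mem_iUnion_arc_iff.not.mp hx)
  have ht := h t (coe_mem_iUnion_arc_iff.not.mp hy)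
  have : ((s : UnitAddCircle), (t : UnitAddCircle)) ∈ arrows K ↔
      ((s : UnitAddCircle), (t : UnitAddCircle)) ∈ arrows L := by
    rw [coe_mem_arrows_iff, coe_mem_arrows_iff, hs.1, hs.2, ht.1]
  exact this

/-- The strands stay inside the unit disk. -/
def InDisk (m : Fin n → ℝ → Plane) : Prop := ∀ i, ∀ u ∈ Icc (-1 : ℝ) 1, m i u ∈ unitDisk

/-- The parameters of the points of the strands; the point `m i u` has parameter `(i, u)`. -/
def strandParams (n : ℕ) : Set (Fin n × ℝ) := univ ×ˢ Icc (-1) 1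

/-- The pairs of distinct parameters at which the strands meet. -/
def strandCrossings (m : Fin n → ℝ → Plane) : Set ((Fin n × ℝ) × (Fin n × ℝ)) :=
  {c ∈ strandParams n ×ˢ strandParams n | c.1 ≠ c.2 ∧ m c.1.1 c.1.2 = m c.2.1 c.2.2}

/-- A choice of the over strand at each crossing of the strands `m`, compatible with the order
`ord` of the strands from top to bottom. -/
def IsResolution (m : Fin n → ℝ → Plane) (ord : Equiv.Perm (Fin n))
    (R : Set ((Fin n × ℝ) × (Fin n × ℝ))) : Prop :=
  R ⊆ strandCrossings m ∧ (∀ c ∈ strandCrossings m, c.swap ∈ R ↔ c ∉ R) ∧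
    ∀ c ∈ R, ord.symm c.1.1 ≤ ord.symm c.2.1

/-- The set `E` consists of the arrows of a diagram that has the part `m` on the given arcs. -/
def IsInnerArrows (m : Fin n → ℝ → Plane) (ord : Equiv.Perm (Fin n)) (a b : Fin n → ℝ)
    (E : Set (UnitAddCircle × UnitAddCircle)) : Prop :=
  ∃ W : Fin n × ℝ → UnitAddCircle, InjOn W (strandParams n) ∧
    (∀ q ∈ strandParams n, W q ∈ arc (a q.1) (b q.1)) ∧
    ∃ R, IsResolution m ord R ∧ E = Prod.map W W '' R

theorem HasPart.exists_section (h : HasPart K φ m a b) :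
    ∃ s : Fin n → ℝ → ℝ, ∀ i, BijOn (s i) (Icc (-1) 1) (Icc (a i) (b i)) ∧
      ∀ u ∈ Icc (-1) 1, K.γ (s i u) = φ (m i u) := by
  choose u hu himage hγ using h.1
  have hbij (i) : BijOn (u i) (Icc (a i) (b i)) (Icc (-1) 1) :=
    himage i ▸ ((hu i).elim StrictMonoOn.injOn StrictAntiOn.injOn).bijOn_image
  refine ⟨fun i => invFunOn (u i) (Icc (a i) (b i)), fun i => ?_⟩
  have hinv := (hbij i).invOn_invFunOn
  have hbij' := (hbij i).symm hinv.symm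
  exact ⟨hbij', fun v hv => by rw [hγ i _ (hbij'.mapsTo hv), hinv.2 hv]⟩

theorem HasPart.le (h : HasPart K φ m a b) (i : Fin n) : a i ≤ b i := by
  obtain ⟨s, hs⟩ := h.exists_section
  exact nonempty_Icc.mp ⟨_, (hs i).1.mapsTo (show (1 : ℝ) ∈ Icc (-1) 1 by simp)⟩

theorem HasPart.mem_outerArrows_or (h : HasPart K φ m a b) (hm : InDisk m)
    {p : UnitAddCircle × UnitAddCircle} (hp : p ∈ arrows K) :
    p ∈ outerArrows K a b ∨ p ∈ (⋃ i, arc (a i) (b i)) ×ˢ ⋃ i, arc (a i) (b i) := by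
  have hin {t : ℝ} (ht : InArcs a b t) : K.γ t ∈ φ '' unitDisk := by
    obtain ⟨i, s, hs, hst⟩ := ht
    obtain ⟨u, -, hu, hγ⟩ := h.1 i
    rw [← K.γ_eq_of_coe_eq (sameParam_iff.mp hst), hγ s hs]
    exact mem_image_of_mem _ (hm i _ (hu ▸ mem_image_of_mem _ hs))
  obtain ⟨s, t, hst, -, rfl⟩ := id hp
  have hiff : InArcs a b s ↔ InArcs a b t :=
    ⟨fun hs => by_contra fun ht => h.2 t ht (hst.1 ▸ hin hs),
      fun ht => by_contra fun hs => h.2 s hs (hst.1 ▸ hin ht)⟩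
  by_cases ht : InArcs a b t
  · exact Or.inr ⟨coe_mem_iUnion_arc_iff.mpr (hiff.mpr ht), coe_mem_iUnion_arc_iff.mpr ht⟩
  · exact Or.inl ⟨hp, coe_mem_iUnion_arc_iff.not.mpr (hiff.not.mpr ht),
      coe_mem_iUnion_arc_iff.not.mpr ht⟩

theorem Layered.le_of_mem_arrows (h : Layered K ord a b) {i j : Fin n}
    {x y : UnitAddCircle} (hx : x ∈ arc (a i) (b i)) (hy : y ∈ arc (a j) (b j))
    (hxy : (x, y) ∈ arrows K) : ord.symm i ≤ ord.symm j := by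
  obtain ⟨s, hs, rfl⟩ := hx
  obtain ⟨t, ht, rfl⟩ := hy
  by_contra! hlt
  obtain ⟨hcross, hover⟩ := coe_mem_arrows_iff.mp hxy
  refine (K.overpass_iff s t (crosses_iff.mpr hcross)).mp hover ?_
  exact h _ _ hlt t (by simpa using ht) s (by simpa using hs) hcross.1.symm

theorem HasPart.exists_parametrization (h : HasPart K φ m a b) (hab : ArcsDisjoint a b)
    (hφ : InjOn φ unitDisk) (hm : InDisk m) :
    ∃ s : Fin n × ℝ → ℝ, InjOn (fun q => (s q : UnitAddCircle)) (strandParams n) ∧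
      (∀ i, BijOn (fun u => s (i, u)) (Icc (-1) 1) (Icc (a i) (b i))) ∧
      ∀ c ∈ strandParams n ×ˢ strandParams n,
        c ∈ strandCrossings m ↔ Crosses K.γ (s c.1) (s c.2) := by
  obtain ⟨s, hs⟩ := h.exists_section
  have hinj : InjOn (fun q : Fin n × ℝ => (s q.1 q.2 : UnitAddCircle)) (strandParams n) := by
    rintro ⟨i, u⟩ ⟨-, hu⟩ ⟨j, v⟩ ⟨-, hv⟩ huv
    obtain ⟨rfl, hst⟩ := hab i j _ ((hs i).1.mapsTo hu) _ ((hs j).1.mapsTo hv)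
      (sameParam_iff.mpr huv)
    exact congrArg (Prod.mk i) ((hs i).1.injOn hu hv hst)
  refine ⟨fun q => s q.1 q.2, hinj, fun i => (hs i).1, fun c hc => ?_⟩
  rw [crosses_iff, (hs c.1.1).2 _ hc.1.2, (hs c.2.1).2 _ hc.2.2,
    hφ.eq_iff (hm _ _ hc.1.2) (hm _ _ hc.2.2), hinj.ne_iff hc.1 hc.2, and_comm]
  exact and_iff_right hc

theorem HasPart.exists_isInnerArrows (h : HasPart K φ m a b) (hab : ArcsDisjoint a b)
    (hφ : InjOn φ unitDisk) (hm : InDisk m) (hlay : Layered K ord a b) :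
    ∃ E, IsInnerArrows m ord a b E ∧ arrows K = outerArrows K a b ∪ E := by
  obtain ⟨s, hinj, hbij, hcross⟩ := h.exists_parametrization hab hφ hm
  set W : Fin n × ℝ → UnitAddCircle := fun q => s q
  have hWarc (q) (hq : q ∈ strandParams n) : W q ∈ arc (a q.1) (b q.1) :=
    mem_image_of_mem _ ((hbij q.1).mapsTo hq.2)
  set R := {c ∈ strandCrossings m | Prod.map W W c ∈ arrows K}
  have hR : IsResolution m ord R := by
    refine ⟨sep_subset _ _, fun c hc => ?_, fun c hc => ?_⟩
    · have hc' : c.swap ∈ strandCrossings m := ⟨hc.1.symm, hc.2.1.symm, hc.2.2.symm⟩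
      simp only [R, mem_ofPred_eq, hc, hc', true_and]
      exact swap_mem_arrows_iff (crosses_iff.mp ((hcross c hc.1).mp hc))
    · exact hlay.le_of_mem_arrows (hWarc _ hc.1.1.1) (hWarc _ hc.1.1.2) hc.2
  have hlift (x) (hx : x ∈ ⋃ i, arc (a i) (b i)) : ∃ q ∈ strandParams n, W q = x := by
    obtain ⟨i, t, ht, rfl⟩ := mem_iUnion.mp hx
    obtain ⟨u, hu, rfl⟩ := (hbij i).surjOn ht
    exact ⟨(i, u), ⟨mem_univ _, hu⟩, rfl⟩
  refine ⟨_, ⟨W, hinj, hWarc, R, hR, rfl⟩, Subset.antisymm (fun p hp => ?_) ?_⟩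
  · refine (h.mem_outerArrows_or hm hp).imp_right fun hp' => ?_
    obtain ⟨q, hq, hqp⟩ := hlift _ hp'.1
    obtain ⟨r, hr, hrp⟩ := hlift _ hp'.2
    obtain rfl : (W q, W r) = p := Prod.ext hqp hrp
    exact ⟨(q, r), ⟨(hcross _ ⟨hq, hr⟩).mpr (crosses_iff.mpr (coe_mem_arrows_iff.mp hp).1), hp⟩,
      rfl⟩
  · rintro _ (hp | ⟨c, hc, rfl⟩)
    exacts [hp.1, hc.2]

theorem Replaces.exists_isInnerArrows (h : Replaces m m' ord a b K L) (hm : InDisk m)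
    (hm' : InDisk m') :
    ∃ E E', IsInnerArrows m ord a b E ∧ IsInnerArrows m' ord a b E' ∧
      arrows K = outerArrows K a b ∪ E ∧ arrows L = outerArrows K a b ∪ E' := by
  obtain ⟨hab, φ, ψ, hφ, hψ, -, -, hK, hL, hlayK, hlayL, hout⟩ := h
  obtain ⟨E, hE, hKE⟩ := hK.exists_isInnerArrows hab hφ.2.1 hm hlayK
  obtain ⟨E', hE', hLE'⟩ := hL.exists_isInnerArrows hab hψ.2.1 hm' hlayL
  exact ⟨E, E', hE, hE', hKE, outerArrows_congr hout ▸ hLE'⟩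

theorem Move.sameParity {P : Equiv.Perm (Fin n) → (Fin n → ℝ) → Prop}
    (h : ∀ K L ord a b, P ord a → Replaces m m' ord a b K L → SameParity (arrows K) (arrows L))
    (hKL : Move m m' P K L) : SameParity (arrows K) (arrows L) := by
  obtain ⟨K', L', hK, hL, ord, a, b, hP, hr | hr⟩ := hKL
  · exact (hK.sameParity.trans (h _ _ _ _ _ hP hr)).trans hL.sameParity.symm
  · exact (hK.sameParity.trans (h _ _ _ _ _ hP hr).symm).trans hL.sameParity.symm

end Moves

section FirstMove

variable {ord : Equiv.Perm (Fin 1)} {a b : Fin 1 → ℝ} {E : Set (UnitAddCircle × UnitAddCircle)}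
  {K L : KnotDiagram}

theorem inDisk_omega1Plain : InDisk omega1Plain := by
  intro i u hu
  have hsq : u ^ 2 ≤ 1 := by nlinarith [hu.1, hu.2]
  simpa [unitDisk, omega1Plain] using hsq

theorem inDisk_omega1Kink : InDisk omega1Kink := by
  intro i u hu
  have hsq : u ^ 2 ≤ 1 := by nlinarith [hu.1, hu.2]
  suffices (u * (4 * u ^ 2 - 1) / 3) ^ 2 + ((1 - u ^ 2) / 2) ^ 2 ≤ 1 by
    simpa [unitDisk, omega1Kink] using this
  nlinarith [sq_nonneg u, sq_nonneg (u ^ 2), mul_nonneg (sq_nonneg u) (sub_nonneg.mpr hsq),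
    mul_nonneg (sq_nonneg (u ^ 2)) (sub_nonneg.mpr hsq)]

theorem strandCrossings_omega1Plain : strandCrossings omega1Plain = ∅ := by
  refine eq_empty_of_forall_notMem ?_
  rintro ⟨⟨i, u⟩, j, v⟩ ⟨-, hne, heq⟩
  obtain rfl := Subsingleton.elim i j
  refine hne (congrArg (Prod.mk i) ?_)
  simpa [omega1Plain] using heq

theorem strandCrossings_omega1Kink :
    strandCrossings omega1Kink = {((0, 1 / 2), (0, -1 / 2)), ((0, -1 / 2), (0, 1 / 2))} := by
  ext ⟨⟨i, u⟩, j, v⟩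
  obtain rfl := Subsingleton.elim 0 i
  obtain rfl := Subsingleton.elim 0 j
  have hself (huv : u ≠ v) : omega1Kink 0 u = omega1Kink 0 v ↔
      u = 1 / 2 ∧ v = -1 / 2 ∨ u = -1 / 2 ∧ v = 1 / 2 := by
    constructor
    · intro h
      have hfst : u * (4 * u ^ 2 - 1) / 3 = v * (4 * v ^ 2 - 1) / 3 := congrArg Prod.fst h
      have hsnd : (1 - u ^ 2) / 2 = (1 - v ^ 2) / 2 := congrArg Prod.snd h
      obtain rfl : v = -u := by
        have : (u - v) * (u + v) = 0 := by linarith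
        linarith [(mul_eq_zero.mp this).resolve_left (sub_ne_zero.mpr huv)]
      have hu : u ≠ 0 := by rintro rfl; simp at huv
      have hroot : u * ((2 * u - 1) * (2 * u + 1)) = 0 := by linarith
      rcases mul_eq_zero.mp ((mul_eq_zero.mp hroot).resolve_left hu) with h | h
      · exact Or.inl ⟨by linarith, by linarith⟩
      · exact Or.inr ⟨by linarith, by linarith⟩
    · rintro (⟨rfl, rfl⟩ | ⟨rfl, rfl⟩) <;> norm_num [omega1Kink]
  simp only [mem_insert_iff, mem_singleton_iff, Prod.mk.injEq, true_and]
  constructor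
  · rintro ⟨-, hne, heq⟩
    exact (hself fun huv => hne (by rw [huv])).mp heq
  · rintro (⟨rfl, rfl⟩ | ⟨rfl, rfl⟩) <;>
      norm_num [strandCrossings, strandParams, omega1Kink]

theorem IsInnerArrows.eq_empty_of_omega1Plain (hE : IsInnerArrows omega1Plain ord a b E) :
    E = ∅ := by
  obtain ⟨W, -, -, R, hR, rfl⟩ := hE
  have : R ⊆ ∅ := strandCrossings_omega1Plain ▸ hR.1
  rw [subset_empty_iff.mp this, image_empty]

theorem IsInnerArrows.eq_singleton_of_omega1Kink (hE : IsInnerArrows omega1Kink ord a b E) :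
    ∃ e ∈ arc (a 0) (b 0) ×ˢ arc (a 0) (b 0), E = {e} := by
  obtain ⟨W, -, hW, R, ⟨hsub, hswap, -⟩, rfl⟩ := hE
  suffices ∃ c ∈ strandCrossings omega1Kink, R = {c} by
    obtain ⟨c, hc, rfl⟩ := this
    refine ⟨_, ?_, image_singleton⟩
    have h₁ := hW _ hc.1.1
    have h₂ := hW _ hc.1.2
    rw [Subsingleton.elim c.1.1 0] at h₁
    rw [Subsingleton.elim c.2.1 0] at h₂
    exact ⟨h₁, h₂⟩
  rw [strandCrossings_omega1Kink] at hsub hswap ⊢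
  have hxor := hswap _ (mem_insert _ _)
  rw [Prod.swap_prod_mk] at hxor
  by_cases h : ((0, 1 / 2), (0, -1 / 2)) ∈ R
  · refine ⟨_, mem_insert _ _, Subset.antisymm (fun c hc => ?_) (singleton_subset_iff.mpr h)⟩
    exact (hsub hc).resolve_right fun hc' => hxor.mp (hc' ▸ hc) h
  · refine ⟨_, mem_insert_of_mem _ rfl, Subset.antisymm (fun c hc => ?_)
      (singleton_subset_iff.mpr (hxor.mpr h))⟩
    exact (hsub hc).resolve_left fun hc' => h (hc' ▸ hc)

theorem Omega1.sameParity (h : Omega1 K L) : SameParity (arrows K) (arrows L) := by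
  refine Move.sameParity (fun K L ord a b _ hKL => ?_) h
  obtain ⟨E, E', hE, hE', hK, hL⟩ :=
    hKL.exists_isInnerArrows inDisk_omega1Plain inDisk_omega1Kink
  obtain rfl := hE.eq_empty_of_omega1Plain
  obtain ⟨e, he, rfl⟩ := hE'.eq_singleton_of_omega1Kink
  rw [hK, hL, union_empty]
  have hsub := compl_subset_compl.mpr (subset_iUnion (fun i => arc (a i) (b i)) 0)
  exact sameParity_union_singleton (isArc_arc _ _)
    (inter_subset_right.trans (prod_mono hsub hsub)) he

end FirstMove

section Strands

variable {n : ℕ} {m : Fin n → ℝ → Plane} {ord : Equiv.Perm (Fin n)} {a b : Fin n → ℝ}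
  {R : Set ((Fin n × ℝ) × (Fin n × ℝ))} {K : KnotDiagram}

theorem IsResolution.mem_iff (hR : IsResolution m ord R)
    (hne : ∀ c ∈ strandCrossings m, c.1.1 ≠ c.2.1) {c : (Fin n × ℝ) × (Fin n × ℝ)} :
    c ∈ R ↔ c ∈ strandCrossings m ∧ ord.symm c.1.1 < ord.symm c.2.1 := by
  constructor
  · exact fun hc => ⟨hR.1 hc, (hR.2.2 c hc).lt_of_ne (ord.symm.injective.ne (hne c (hR.1 hc)))⟩
  · rintro ⟨hc, hlt⟩
    by_contra hcR
    exact hlt.not_ge (hR.2.2 _ ((hR.2.1 c hc).mpr hcR))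

theorem ArcsDisjoint.pairwise_disjoint_comp (h : ArcsDisjoint a b) (ord : Equiv.Perm (Fin n)) :
    Pairwise (Disjoint on fun k => arc (a (ord k)) (b (ord k))) :=
  h.pairwise_disjoint.comp_of_injective ord.injective

theorem outerArrows_subset (ord : Equiv.Perm (Fin n)) : outerArrows K a b ⊆
    (⋃ k, arc (a (ord k)) (b (ord k)))ᶜ ×ˢ (⋃ k, arc (a (ord k)) (b (ord k)))ᶜ := by
  rw [ord.surjective.iUnion_comp fun i => arc (a i) (b i)]
  exact inter_subset_right

end Strands

section SecondMove

variable {ord : Equiv.Perm (Fin 2)} {a b : Fin 2 → ℝ} {E : Set (UnitAddCircle × UnitAddCircle)}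
  {K L : KnotDiagram}

theorem inDisk_omega2Plain : InDisk omega2Plain := by
  intro i u hu
  have hsq : u ^ 2 ≤ 1 := by nlinarith [hu.1, hu.2]
  suffices (4 * u / 5) ^ 2 + (3 / 5) ^ 2 ≤ 1 by
    fin_cases i <;> simpa [unitDisk, omega2Plain] using this
  linarith

theorem inDisk_omega2Crossed : InDisk omega2Crossed := by
  intro i u hu
  have hsq : u ^ 2 ≤ 1 := by nlinarith [hu.1, hu.2]
  suffices (4 * u / 5) ^ 2 + ((4 * u ^ 2 - 1) / 5) ^ 2 ≤ 1 by
    fin_cases i <;> simpa [unitDisk, omega2Crossed] using this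
  nlinarith [mul_nonneg (sq_nonneg u) (sub_nonneg.mpr hsq)]

theorem strandCrossings_omega2Plain : strandCrossings omega2Plain = ∅ := by
  refine eq_empty_of_forall_notMem ?_
  rintro ⟨⟨i, u⟩, j, v⟩ ⟨-, hne, heq⟩
  have hfst : 4 * u / 5 = 4 * v / 5 := by
    fin_cases i <;> fin_cases j <;> exact congrArg Prod.fst heq
  have hsnd := congrArg Prod.snd heq
  have hij : i = j := by
    fin_cases i <;> fin_cases j <;> first | rfl | norm_num [omega2Plain] at hsnd
  exact hne (Prod.ext hij (by linarith))

theorem strandCrossings_omega2Crossed : strandCrossings omega2Crossed =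
    {c | c.1.1 ≠ c.2.1 ∧ c.1.2 = c.2.2 ∧ (c.1.2 = 1 / 2 ∨ c.1.2 = -1 / 2)} := by
  ext ⟨⟨i, u⟩, j, v⟩
  constructor
  · rintro ⟨-, hne, heq⟩
    obtain rfl : u = v := by
      have : 4 * u / 5 = 4 * v / 5 := by
        fin_cases i <;> fin_cases j <;> exact congrArg Prod.fst heq
      linarith
    have hij : i ≠ j := fun hij => hne (by rw [hij])
    have hsnd : (4 * u ^ 2 - 1) / 5 = -((4 * u ^ 2 - 1) / 5) := by
      have := congrArg Prod.snd heq
      fin_cases i <;> fin_cases j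
      exacts [absurd rfl hij, this, this.symm, absurd rfl hij]
    have hroot : (u - 1 / 2) * (u + 1 / 2) = 0 := by linarith
    exact ⟨hij, rfl, (mul_eq_zero.mp hroot).imp (fun h => by linarith) fun h => by linarith⟩
  · rintro ⟨hij, huv, hu⟩
    obtain rfl : u = v := huv
    rcases hu with rfl | rfl <;> fin_cases i <;> fin_cases j <;>
      first
      | exact absurd rfl hij
      | norm_num [strandCrossings, strandParams, omega2Crossed]

theorem IsInnerArrows.eq_empty_of_omega2Plain (hE : IsInnerArrows omega2Plain ord a b E) :
    E = ∅ := by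
  obtain ⟨W, -, -, R, hR, rfl⟩ := hE
  have : R ⊆ ∅ := strandCrossings_omega2Plain ▸ hR.1
  rw [subset_empty_iff.mp this, image_empty]

theorem IsInnerArrows.eq_pair_of_omega2Crossed (hE : IsInnerArrows omega2Crossed ord a b E) :
    ∃ e ∈ arc (a (ord 0)) (b (ord 0)) ×ˢ arc (a (ord 1)) (b (ord 1)),
      ∃ e' ∈ arc (a (ord 0)) (b (ord 0)) ×ˢ arc (a (ord 1)) (b (ord 1)),
        e ≠ e' ∧ E = {e, e'} := by
  obtain ⟨W, hinj, hW, R, hR, rfl⟩ := hE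
  obtain rfl : R = {((ord 0, 1 / 2), (ord 1, 1 / 2)), ((ord 0, -1 / 2), (ord 1, -1 / 2))} := by
    ext ⟨⟨i, u⟩, j, v⟩
    obtain ⟨p, rfl⟩ := ord.surjective i
    obtain ⟨q, rfl⟩ := ord.surjective j
    rw [hR.mem_iff fun c hc => by rw [strandCrossings_omega2Crossed] at hc; exact hc.1,
      strandCrossings_omega2Crossed]
    simp only [mem_ofPred_eq, mem_insert_iff, mem_singleton_iff, Prod.mk.injEq, ne_eq,
      EmbeddingLike.apply_eq_iff_eq, Equiv.symm_apply_apply]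
    have hlt : p < q ↔ p = 0 ∧ q = 1 := by lia
    grind
  have hmem (i) {u : ℝ} (hu : u ∈ Icc (-1) 1) : (i, u) ∈ strandParams 2 := ⟨mem_univ i, hu⟩
  have hpos : (1 / 2 : ℝ) ∈ Icc (-1) 1 := by norm_num
  have hneg : (-1 / 2 : ℝ) ∈ Icc (-1) 1 := by norm_num
  refine ⟨_, ⟨hW _ (hmem _ hpos), hW _ (hmem _ hpos)⟩, _,
    ⟨hW _ (hmem _ hneg), hW _ (hmem _ hneg)⟩, fun h => ?_, image_pair _ _ _⟩
  have := congrArg Prod.snd (hinj (hmem _ hpos) (hmem _ hneg) (congrArg Prod.fst h))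
  norm_num at this

theorem Omega2.sameParity (h : Omega2 K L) : SameParity (arrows K) (arrows L) := by
  refine Move.sameParity (fun K L ord a b _ hKL => ?_) h
  obtain ⟨E, E', hE, hE', hK, hL⟩ :=
    hKL.exists_isInnerArrows inDisk_omega2Plain inDisk_omega2Crossed
  obtain rfl := hE.eq_empty_of_omega2Plain
  obtain ⟨e, he, e', he', hne, rfl⟩ := hE'.eq_pair_of_omega2Crossed
  rw [hK, hL, union_empty]
  exact sameParity_union_pair (fun _ => isArc_arc _ _) (hKL.1.pairwise_disjoint_comp ord)
    (outerArrows_subset ord) hne he he'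

end SecondMove

section ThirdMove

variable {m : Fin 3 → ℝ → Plane} {ord : Equiv.Perm (Fin 3)} {a b : Fin 3 → ℝ}
  {E : Set (UnitAddCircle × UnitAddCircle)} {K L : KnotDiagram}

/-- Three simple strands in the disk, any two of which cross exactly once: the strand `i` crosses
the strand `j` at the parameter `x i j`. -/
def IsTriangle (m : Fin 3 → ℝ → Plane) : Prop :=
  InDisk m ∧ ∃ x : Fin 3 → Fin 3 → ℝ,
    strandCrossings m = {c | c.1.1 ≠ c.2.1 ∧ c.1.2 = x c.1.1 c.2.1 ∧ c.2.2 = x c.2.1 c.1.1}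

theorem IsTriangle.of_lt (hm : InDisk m) (hinj : ∀ i, Injective (m i)) (x : Fin 3 → Fin 3 → ℝ)
    (hx : ∀ i j, x i j ∈ Icc (-1) 1)
    (h : ∀ i j, i < j → ∀ u ∈ Icc (-1) 1, ∀ v ∈ Icc (-1) 1,
      m i u = m j v ↔ u = x i j ∧ v = x j i) : IsTriangle m := by
  have hne {i j} (hij : i ≠ j) {u v} (hu : u ∈ Icc (-1) 1) (hv : v ∈ Icc (-1) 1) :
      m i u = m j v ↔ u = x i j ∧ v = x j i := by
    rcases hij.lt_or_gt with hlt | hgt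
    · exact h i j hlt u hu v hv
    · rw [eq_comm, h j i hgt v hv u hu, and_comm]
  refine ⟨hm, x, ?_⟩
  ext ⟨⟨i, u⟩, j, v⟩
  constructor
  · rintro ⟨⟨⟨-, hu⟩, -, hv⟩, hiu, heq⟩
    have hij : i ≠ j := by
      rintro rfl
      exact hiu (congrArg (Prod.mk i) (hinj i heq))
    exact ⟨hij, (hne hij hu hv).mp heq⟩
  · rintro ⟨hij, hu, hv⟩
    obtain rfl : u = x i j := hu
    obtain rfl : v = x j i := hv
    exact ⟨⟨⟨mem_univ _, hx i j⟩, mem_univ _, hx j i⟩, fun h => hij (congrArg Prod.fst h),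
      (hne hij (hx i j) (hx j i)).mpr ⟨rfl, rfl⟩⟩

theorem IsTriangle.comp (h : IsTriangle m) {F : Plane → Plane} (hF : Injective F)
    (hmaps : MapsTo F unitDisk unitDisk) (e : Equiv.Perm (Fin 3)) :
    IsTriangle fun i u => F (m (e i) u) := by
  obtain ⟨hm, x, hx⟩ := h
  refine ⟨fun i u hu => hmaps (hm (e i) u hu), fun i j => x (e i) (e j), ?_⟩
  ext ⟨⟨i, u⟩, j, v⟩
  have := Set.ext_iff.mp hx ((e i, u), (e j, v))
  simpa [strandCrossings, strandParams, hF.eq_iff] using this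

theorem inDisk_omega3Upper : InDisk omega3Upper := by
  intro i u hu
  have hsq : u ^ 2 ≤ 1 := by nlinarith [hu.1, hu.2]
  have hline : (3 * u / 5) ^ 2 + (4 * u / 5) ^ 2 ≤ 1 := by linarith
  have hparabola : u ^ 2 + ((1 - u ^ 2) / 2) ^ 2 ≤ 1 := by nlinarith [sq_nonneg u]
  fin_cases i
  · simpa [unitDisk, omega3Upper] using hline
  · simpa [unitDisk, omega3Upper] using hline
  · simpa [unitDisk, omega3Upper] using hparabola

theorem omega3Upper_injective (i : Fin 3) : Injective (omega3Upper i) := by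
  intro u v h
  have := congrArg Prod.fst h
  fin_cases i <;> simpa [omega3Upper] using this

theorem omega3Upper_zero_eq_one_iff {u v : ℝ} :
    omega3Upper 0 u = omega3Upper 1 v ↔ u = 0 ∧ v = 0 := by
  constructor
  · intro h
    have hfst : 3 * u / 5 = 3 * v / 5 := congrArg Prod.fst h
    have hsnd : 4 * u / 5 = -(4 * v / 5) := congrArg Prod.snd h
    constructor <;> linarith
  · rintro ⟨rfl, rfl⟩
    simp [omega3Upper]

theorem omega3Upper_zero_eq_two_iff {u v : ℝ} (hu : u ∈ Icc (-1) 1) :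
    omega3Upper 0 u = omega3Upper 2 v ↔ u = 5 / 9 ∧ v = 1 / 3 := by
  constructor
  · intro h
    obtain rfl : 3 * u / 5 = v := congrArg Prod.fst h
    have hsnd : 4 * u / 5 = (1 - (3 * u / 5) ^ 2) / 2 := congrArg Prod.snd h
    have hroot : (9 * u - 5) * (u + 5) = 0 := by linarith
    have := (mul_eq_zero.mp hroot).resolve_right (by linarith [hu.1])
    constructor <;> linarith
  · rintro ⟨rfl, rfl⟩
    change (3 * (5 / 9) / 5, 4 * (5 / 9) / 5) = ((1 / 3 : ℝ), ((1 - (1 / 3) ^ 2) / 2 : ℝ))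
    norm_num

theorem omega3Upper_one_eq_two_iff {u v : ℝ} (hu : u ∈ Icc (-1) 1) :
    omega3Upper 1 u = omega3Upper 2 v ↔ u = -5 / 9 ∧ v = -1 / 3 := by
  constructor
  · intro h
    obtain rfl : 3 * u / 5 = v := congrArg Prod.fst h
    have hsnd : -(4 * u / 5) = (1 - (3 * u / 5) ^ 2) / 2 := congrArg Prod.snd h
    have hroot : (9 * u + 5) * (u - 5) = 0 := by linarith
    have := (mul_eq_zero.mp hroot).resolve_right (by linarith [hu.2])
    constructor <;> linarith
  · rintro ⟨rfl, rfl⟩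
    change (3 * (-5 / 9) / 5, -(4 * (-5 / 9) / 5)) = ((-1 / 3 : ℝ), ((1 - (-1 / 3) ^ 2) / 2 : ℝ))
    norm_num

theorem isTriangle_omega3Upper : IsTriangle omega3Upper := by
  refine .of_lt inDisk_omega3Upper omega3Upper_injective
    ![![0, 0, 5 / 9], ![0, 0, -5 / 9], ![1 / 3, -1 / 3, 0]] (fun i j => ?_)
    fun i j hij u hu v _ => ?_
  · fin_cases i <;> fin_cases j <;> norm_num
  · obtain ⟨rfl, rfl⟩ | ⟨rfl, rfl⟩ | ⟨rfl, rfl⟩ :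
        i = 0 ∧ j = 1 ∨ i = 0 ∧ j = 2 ∨ i = 1 ∧ j = 2 := by lia
    exacts [omega3Upper_zero_eq_one_iff, omega3Upper_zero_eq_two_iff hu,
      omega3Upper_one_eq_two_iff hu]

theorem omega3Lower_eq (i : Fin 3) (u : ℝ) :
    omega3Lower i u = Prod.map id Neg.neg (omega3Upper (Equiv.swap 0 1 i) u) := by
  fin_cases i <;> simp [omega3Lower, omega3Upper, Equiv.swap_apply_of_ne_of_ne]

theorem isTriangle_omega3Lower : IsTriangle omega3Lower := by
  rw [funext₂ omega3Lower_eq]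
  exact isTriangle_omega3Upper.comp (injective_id.prodMap neg_injective)
    (fun p hp => by simpa [unitDisk] using hp) _

theorem IsTriangle.isInnerArrows_eq_range (hm : IsTriangle m) (hE : IsInnerArrows m ord a b E) :
    ∃ e : {p : Fin 3 × Fin 3 // p.1 < p.2} → UnitAddCircle × UnitAddCircle,
      (∀ p, e p ∈ arc (a (ord p.1.1)) (b (ord p.1.1)) ×ˢ arc (a (ord p.1.2)) (b (ord p.1.2))) ∧
        E = range e := by
  obtain ⟨-, x, hx⟩ := hm
  obtain ⟨W, -, hW, R, hR, rfl⟩ := hE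
  set c : {p : Fin 3 × Fin 3 // p.1 < p.2} → (Fin 3 × ℝ) × (Fin 3 × ℝ) := fun p =>
    ((ord p.1.1, x (ord p.1.1) (ord p.1.2)), (ord p.1.2, x (ord p.1.2) (ord p.1.1)))
  have hcR : range c = R := by
    ext d
    rw [hR.mem_iff fun d hd => by rw [hx] at hd; exact hd.1, hx]
    constructor
    · rintro ⟨p, rfl⟩
      exact ⟨⟨ord.injective.ne p.2.ne, rfl, rfl⟩, by simpa [c] using p.2⟩
    · obtain ⟨⟨i, u⟩, j, v⟩ := d
      rintro ⟨⟨-, hu, hv⟩, hlt⟩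
      refine ⟨⟨(ord.symm i, ord.symm j), hlt⟩, ?_⟩
      obtain rfl : u = x i j := hu
      obtain rfl : v = x j i := hv
      simp [c]
  have hcmem (p) : c p ∈ strandCrossings m := hR.1 (hcR ▸ mem_range_self p)
  exact ⟨Prod.map W W ∘ c, fun p => ⟨hW _ (hcmem p).1.1, hW _ (hcmem p).1.2⟩, by
    rw [range_comp, hcR]⟩

theorem Omega3Descending.sameParity (h : Omega3Descending K L) :
    SameParity (arrows K) (arrows L) := by
  refine Move.sameParity (fun K L ord a b hcyc hKL => ?_) h
  obtain ⟨E, E', hE, hE', hK, hL⟩ :=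
    hKL.exists_isInnerArrows inDisk_omega3Upper isTriangle_omega3Lower.1
  obtain ⟨e, he, rfl⟩ := isTriangle_omega3Upper.isInnerArrows_eq_range hE
  obtain ⟨e', he', rfl⟩ := isTriangle_omega3Lower.isInnerArrows_eq_range hE'
  obtain ⟨hab, φ, -, -, -, -, -, hpart, -⟩ := hKL
  have hleft (k) : (a (ord k) : UnitAddCircle) ∈ arc (a (ord k)) (b (ord k)) :=
    mem_image_of_mem _ (left_mem_Icc.mpr (hpart.le _))
  have hdisj := hab.pairwise_disjoint_comp ord
  rw [hK, hL]
  refine sameParity_union_triangle (fun _ => isArc_arc _ _) hdisj (outerArrows_subset ord)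
    (fun x hx y hy z hz => ?_) he he'
  exact (isArc_arc _ _).sbtw_of_disjoint (isArc_arc _ _) (isArc_arc _ _)
    (hdisj (by decide)) (hdisj (by decide)) (hdisj (by decide)) (hleft 0) hx (hleft 1) hy
    (hleft 2) hz (inCyclicOrder_iff_sbtw.mp hcyc)

end ThirdMove

section Inverse

variable {n : ℕ} {a b : Fin n → ℝ} {m m' : Fin n → ℝ → Plane} {ord : Equiv.Perm (Fin n)}
  {K L : KnotDiagram}

theorem IsCircleDiffeo.neg_comp_neg {σ : ℝ → ℝ} (hσ : IsCircleDiffeo σ) :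
    IsCircleDiffeo fun t => -σ (-t) := by
  refine ⟨(hσ.1.comp contDiff_neg).neg, fun t => ?_, fun t => ?_⟩
  · have := hσ.2.1 (-(t + 1))
    rw [show -(t + 1) + 1 = -t by ring] at this
    linarith
  · rw [deriv.fun_neg, deriv_comp_neg, neg_neg]
    exact hσ.2.2 _

theorem KnotDiagram.inverse_inverse (K : KnotDiagram) : K.inverse.inverse = K := by
  cases K
  simp [KnotDiagram.inverse]

theorem KnotDiagram.Equivalent.inverse (h : K.Equivalent L) : K.inverse.Equivalent L.inverse := by
  obtain ⟨F, hF, σ, hσ, h⟩ := h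
  refine ⟨F, hF, _, hσ.neg_comp_neg, fun t => ?_⟩
  simpa [KnotDiagram.inverse] using h (-t)

theorem KnotDiagram.Same.inverse (h : K.Same L) : K.inverse.Same L.inverse := by
  obtain ⟨σ, hσ, h⟩ := h
  refine ⟨_, hσ.neg_comp_neg, fun t => ?_⟩
  simpa [KnotDiagram.inverse] using h (-t)

theorem neg_mem_Icc_iff {s α β : ℝ} : -s ∈ Icc α β ↔ s ∈ Icc (-β) (-α) := by
  rw [← mem_neg, neg_Icc]

theorem sameParam_neg_iff {s t : ℝ} : SameParam (-s) (-t) ↔ SameParam s t := by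
  rw [sameParam_iff, sameParam_iff, AddCircle.coe_neg, AddCircle.coe_neg, neg_inj]

theorem ArcsDisjoint.neg (h : ArcsDisjoint a b) : ArcsDisjoint (-b) (-a) := by
  intro i j s hs t ht hst
  have := h i j (-s) (neg_mem_Icc_iff.mpr hs) (-t) (neg_mem_Icc_iff.mpr ht)
    (sameParam_neg_iff.mpr hst)
  exact ⟨this.1, neg_injective this.2⟩

theorem InArcs.neg {t : ℝ} (h : InArcs a b (-t)) : InArcs (-b) (-a) t := by
  obtain ⟨i, s, hs, hst⟩ := h
  exact ⟨i, -s, neg_mem_Icc_iff.mp (by rwa [neg_neg]), sameParam_neg_iff.mp (by rwa [neg_neg])⟩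

theorem ArcsDisjoint.inCyclicOrder_neg_iff_not (hab : ArcsDisjoint a b) (hle : ∀ i, a i ≤ b i)
    {i j k : Fin n} (hij : i ≠ j) (hjk : j ≠ k) (hki : k ≠ i) :
    InCyclicOrder (-b i) (-b j) (-b k) ↔ ¬ InCyclicOrder (a i) (a j) (a k) := by
  have hdisj := hab.pairwise_disjoint
  have hleft (l) : (a l : UnitAddCircle) ∈ arc (a l) (b l) :=
    mem_image_of_mem _ (left_mem_Icc.mpr (hle l))
  have hright (l) : (b l : UnitAddCircle) ∈ arc (a l) (b l) :=
    mem_image_of_mem _ (right_mem_Icc.mpr (hle l))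
  have move {x y : Fin n → UnitAddCircle} (hx : ∀ l, x l ∈ arc (a l) (b l))
      (hy : ∀ l, y l ∈ arc (a l) (b l)) (h : sbtw (x k) (x j) (x i)) : sbtw (y k) (y j) (y i) :=
    (isArc_arc _ _).sbtw_of_disjoint (isArc_arc _ _) (isArc_arc _ _) (hdisj hjk.symm)
      (hdisj hij.symm) (hdisj hki.symm) (hx k) (hy k) (hx j) (hy j) (hx i) (hy i) h
  have hne {l l'} (hl : l ≠ l') : (a l : UnitAddCircle) ≠ a l' :=
    (hdisj hl).ne_of_mem (hleft l) (hleft l')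
  rw [inCyclicOrder_neg_iff, inCyclicOrder_iff_sbtw, inCyclicOrder_iff_sbtw,
    ← sbtw_swap_iff_not (hne hij) (hne hjk) (hne hki)]
  exact ⟨move hright hleft, move hleft hright⟩

theorem HasPart.inverse {φ : Plane → Plane} (h : HasPart K φ m a b) :
    HasPart K.inverse φ m (-b) (-a) := by
  refine ⟨fun i => ?_, fun t ht => h.2 (-t) fun ht' => ht ht'.neg⟩
  obtain ⟨u, hmono, himage, hγ⟩ := h.1 i
  have hneg : StrictAntiOn Neg.neg (Icc (-b i) (-a i)) := fun _ _ _ _ h => neg_lt_neg h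
  have hmaps : MapsTo Neg.neg (Icc (-b i) (-a i)) (Icc (a i) (b i)) := fun _ hs =>
    neg_mem_Icc_iff.mpr hs
  refine ⟨u ∘ Neg.neg, ?_, ?_, fun t ht => hγ (-t) (hmaps ht)⟩
  · exact hmono.symm.imp (fun hu => hu.comp hneg hmaps) fun hu => hu.comp_strictAntiOn hneg hmaps
  · rw [image_comp, image_neg_eq_neg, Pi.neg_apply, Pi.neg_apply, neg_Icc, neg_neg, neg_neg, himage]

theorem Layered.inverse (h : Layered K ord a b) : Layered K.inverse ord (-b) (-a) :=
  fun p q hpq s hs t ht hst =>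
    h p q hpq (-s) (neg_mem_Icc_iff.mpr hs) (-t) (neg_mem_Icc_iff.mpr ht) hst

theorem Replaces.inverse (h : Replaces m m' ord a b K L) :
    Replaces m m' ord (-b) (-a) K.inverse L.inverse := by
  obtain ⟨hab, φ, ψ, hφ, hψ, himage, hcircle, hK, hL, hlayK, hlayL, hout⟩ := h
  exact ⟨hab.neg, φ, ψ, hφ, hψ, himage, hcircle, hK.inverse, hL.inverse, hlayK.inverse,
    hlayL.inverse, fun t ht => hout (-t) fun ht' => ht ht'.neg⟩

theorem Replaces.le (h : Replaces m m' ord a b K L) (i : Fin n) : a i ≤ b i := by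
  obtain ⟨-, φ, -, -, -, -, -, hK, -⟩ := h
  exact hK.le i

theorem Move.inverse {P Q : Equiv.Perm (Fin n) → (Fin n → ℝ) → Prop}
    (hPQ : ∀ ord a b, ArcsDisjoint a b → (∀ i, a i ≤ b i) → P ord a → Q ord (-b))
    (h : Move m m' P K L) : Move m m' Q K.inverse L.inverse := by
  obtain ⟨K', L', hK, hL, ord, a, b, hP, hr⟩ := h
  refine ⟨_, _, hK.inverse, hL.inverse, ord, -b, -a, ?_, hr.imp Replaces.inverse Replaces.inverse⟩
  rcases hr with hr | hr <;> exact hPQ ord a b hr.1 hr.le hP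

theorem Omega1.inverse (h : Omega1 K L) : Omega1 K.inverse L.inverse :=
  Move.inverse (fun _ _ _ _ _ _ => trivial) h

theorem Omega2.inverse (h : Omega2 K L) : Omega2 K.inverse L.inverse :=
  Move.inverse (fun _ _ _ _ _ _ => trivial) h

theorem Omega3Ascending.inverse (h : Omega3Ascending K L) :
    Omega3Descending K.inverse L.inverse := by
  refine Move.inverse (fun ord a b hab hle hP => ?_) h
  exact (hab.inCyclicOrder_neg_iff_not hle (by simp) (by simp) (by simp)).mpr hP

theorem Omega3Descending.inverse (h : Omega3Descending K L) :
    Omega3Ascending K.inverse L.inverse := by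
  refine Move.inverse (fun ord a b hab hle hP => ?_) h
  exact (hab.inCyclicOrder_neg_iff_not hle (by simp) (by simp) (by simp)).not.mpr (not_not.mpr hP)

end Inverse

section Transformations

variable {n : ℕ} {D : Fin (n + 1) → KnotDiagram} {kind : Fin n → StepKind} {k : StepKind}
  {K L : KnotDiagram}

/-- The kind of a step after the orientation of the knot has been reversed. -/
def StepKind.reverse : StepKind → StepKind
  | .equivalence => .equivalence
  | .omega1 => .omega1
  | .omega2 => .omega2
  | .omega3Ascending => .omega3Descending
  | .omega3Descending => .omega3Ascending

theorem StepKind.reverse_eq_omega3Ascending_iff :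
    k.reverse = .omega3Ascending ↔ k = .omega3Descending := by
  cases k <;> simp [reverse]

theorem Step.inverse (h : Step k K L) : Step k.reverse K.inverse L.inverse := by
  cases k
  · exact KnotDiagram.Equivalent.inverse h
  · exact Omega1.inverse h
  · exact Omega2.inverse h
  · exact Omega3Ascending.inverse h
  · exact Omega3Descending.inverse h

theorem IsTransformation.inverse (hD : IsTransformation D kind) :
    IsTransformation (fun i => (D i).inverse) fun i => (kind i).reverse :=
  fun i => (hD i).inverse

theorem Step.sameParity (h : Step k K L) (hk : k ≠ .omega3Ascending) :
    SameParity (arrows K) (arrows L) := by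
  cases k
  · exact KnotDiagram.Equivalent.sameParity h
  · exact Omega1.sameParity h
  · exact Omega2.sameParity h
  · exact absurd rfl hk
  · exact Omega3Descending.sameParity h

theorem IsTransformation.sameParity (hD : IsTransformation D kind)
    (hkind : ∀ i, kind i ≠ .omega3Ascending) (i : Fin (n + 1)) :
    SameParity (arrows (D 0)) (arrows (D i)) := by
  induction i using Fin.induction with
  | zero => exact .refl _
  | succ i ih => exact ih.trans ((hD i).sameParity (hkind i))

end Transformations

section FigureEight

variable {K : KnotDiagram} {t : Fin 8 → ℝ}

/-- The other passage through the crossing that is passed at the `i`-th place. -/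
def partner : Fin 8 → Fin 8 := ![3, 6, 5, 0, 7, 2, 1, 4]

/-- The parameters `t 0, …, t 7` are the successive passages of the diagram through the crossings
of the figure eight knot. -/
structure IsFigureEightAt (K : KnotDiagram) (t : Fin 8 → ℝ) : Prop where
  strictMono : StrictMono t
  last_lt : t 7 < t 0 + 1
  γ_partner : ∀ i, K.γ (t i) = K.γ (t (partner i))
  exists_of_crosses : ∀ r s, Crosses K.γ r s → ∃ i, SameParam (t i) r

theorem KnotDiagram.IsFigureEight.exists_isFigureEightAt (h : K.IsFigureEight) :
    ∃ t, IsFigureEightAt K t ∧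
      ((∀ i, t i ∈ K.overpass ↔ Even (i : ℕ)) ∨ ∀ i, t i ∈ K.overpass ↔ Odd (i : ℕ)) := by
  obtain ⟨t, ht, ht', h₁, h₂, h₃, h₄, hall, hover⟩ := h
  refine ⟨t, ⟨ht, ht', fun i => ?_, hall⟩, hover⟩
  fin_cases i
  exacts [h₁, h₂, h₃, h₁.symm, h₄, h₃.symm, h₂.symm, h₄.symm]

theorem IsFigureEightAt.inverse (h : IsFigureEightAt K t) :
    IsFigureEightAt K.inverse fun i => -t i.rev := by
  refine ⟨fun i j hij => neg_lt_neg (h.strictMono (Fin.rev_lt_rev.mpr hij)), ?_, fun i => ?_,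
    fun r s hrs => ?_⟩
  · have := h.last_lt
    change -t 0 < -t 7 + 1
    linarith
  · have hrev : ∀ i : Fin 8, (partner i).rev = partner i.rev := by decide
    simp only [KnotDiagram.inverse, neg_neg, hrev]
    exact h.γ_partner _
  · obtain ⟨i, hi⟩ := h.exists_of_crosses _ _ (KnotDiagram.crosses_neg.mp hrs)
    exact ⟨i.rev, by simpa using sameParam_neg_iff.mpr hi⟩

theorem IsFigureEightAt.strictCyclicMono_coe (h : IsFigureEightAt K t) :
    StrictCyclicMono fun i => (t i : UnitAddCircle) :=
  strictCyclicMono_coe_comp h.strictMono fun i j =>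
    calc t i ≤ t 7 := h.strictMono.monotone (Fin.le_last i)
      _ < t 0 + 1 := h.last_lt
      _ ≤ t j + 1 := by gcongr; exact h.strictMono.monotone (Fin.zero_le j)

theorem IsFigureEightAt.coe_injective (h : IsFigureEightAt K t) :
    Injective fun i => (t i : UnitAddCircle) := by
  intro i j hij
  by_contra hne
  have exists_sbtw : ∀ i j : Fin 8, i ≠ j → ∃ k, sbtw i j k ∨ sbtw i k j := by decide
  obtain ⟨k, hk | hk⟩ := exists_sbtw i j hne
  · have := h.strictCyclicMono_coe hk
    exact sbtw_irrefl_left (hij ▸ this)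
  · have := h.strictCyclicMono_coe hk
    exact sbtw_irrefl_left_right (hij ▸ this)

theorem IsFigureEightAt.arrows_eq (h : IsFigureEightAt K t) :
    arrows K = (fun i => ((t i : UnitAddCircle), (t (partner i) : UnitAddCircle))) ''
      {i | t i ∈ K.overpass} := by
  have crosses {i j : Fin 8} (hγ : K.γ (t i) = K.γ (t j)) (hij : i ≠ j) :
      Crosses K.γ (t i) (t j) := crosses_iff.mpr ⟨hγ, h.coe_injective.ne hij⟩
  have ne_partner : ∀ i : Fin 8, i ≠ partner i := by decide
  refine Subset.antisymm ?_ ?_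
  · rintro _ ⟨r, s, hrs, hover, rfl⟩
    obtain ⟨hγ, hne⟩ := crosses_iff.mp hrs
    obtain ⟨i, hi⟩ := h.exists_of_crosses r s hrs
    obtain ⟨j, hj⟩ := h.exists_of_crosses s r (crosses_iff.mpr ⟨hγ.symm, hne.symm⟩)
    rw [sameParam_iff] at hi hj
    rw [← K.γ_eq_of_coe_eq hi, ← K.γ_eq_of_coe_eq hj] at hγ
    rw [← hi, ← hj] at hne ⊢
    obtain rfl : j = partner i := by
      by_contra hj'
      have hp := (h.γ_partner i).symm
      exact K.no_triple _ _ _ (crosses hp (ne_partner i).symm)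
        (crosses hγ fun hij => hne (by rw [hij])) (crosses (hp.trans hγ) (Ne.symm hj'))
    exact mem_image_of_mem _ ((K.mem_overpass_of_coe_eq hi).mpr hover)
  · rintro _ ⟨i, hover, rfl⟩
    exact ⟨_, _, crosses (h.γ_partner i) (ne_partner i), hover, rfl⟩

theorem IsFigureEightAt.finite_arrows (h : IsFigureEightAt K t) : (arrows K).Finite :=
  h.arrows_eq ▸ toFinite _

theorem IsFigureEightAt.ncard_patternSets_of_odd (h : IsFigureEightAt K t)
    (hodd : ∀ i, t i ∈ K.overpass ↔ Odd (i : ℕ)) : (patternSets (arrows K)).ncard = 1 := by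
  set x : Fin 8 → UnitAddCircle := fun m => t (m + 1)
  have hshift : StrictCyclicMono fun m : Fin 8 => m + 1 := by unfold StrictCyclicMono; decide
  have hc : IsPattern fun k => (x (overIndex k), x (underIndex k)) :=
    ⟨x, h.strictCyclicMono_coe.comp hshift, fun _ => rfl⟩
  have hodd_iff : ∀ i : Fin 8, Odd (i : ℕ) ↔ ∃ k, overIndex k + 1 = i := by decide
  have hpartner : ∀ k, partner (overIndex k + 1) = underIndex k + 1 := by decide
  have harrows : arrows K = range fun k => (x (overIndex k), x (underIndex k)) := by
    have hset : {i | t i ∈ K.overpass} = range fun k => overIndex k + 1 := by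
      ext i
      exact (hodd i).trans (hodd_iff i)
    rw [h.arrows_eq, hset, ← range_comp]
    simp only [comp_def, hpartner, x]
  rw [harrows, hc.patternSets_range, ncard_singleton]

theorem IsFigureEightAt.ncard_patternSets_of_even (h : IsFigureEightAt K t)
    (heven : ∀ i, t i ∈ K.overpass ↔ Even (i : ℕ)) : (patternSets (arrows K)).ncard = 0 := by
  suffices hempty : patternSets (arrows K) = ∅ by rw [hempty, ncard_empty]
  refine eq_empty_of_forall_notMem ?_
  rintro _ ⟨hsub, c, hc, rfl⟩
  have hindex (k) : ∃ i : Fin 8, Even (i : ℕ) ∧ (↑(t i), ↑(t (partner i))) = c k := by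
    obtain ⟨i, hi, hik⟩ := h.arrows_eq ▸ hsub ⟨k, rfl⟩
    exact ⟨i, (heven i).mp hi, hik⟩
  choose i hi hic using hindex
  have hne : i 1 ≠ i 2 := fun h12 => absurd
    (hc.injective ((hic 1).symm.trans (h12 ▸ hic 2))) (by decide)
  obtain ⟨x, hx, hcx⟩ := hc
  have hover (k) : (t (i k) : UnitAddCircle) = x (overIndex k) :=
    congrArg Prod.fst ((hic k).trans (hcx k))
  have hunder (k) : (t (partner (i k)) : UnitAddCircle) = x (underIndex k) :=
    congrArg Prod.snd ((hic k).trans (hcx k))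
  have hsbtw {k} (hk : sbtw (overIndex 0) (overIndex k) (underIndex 0)) :
      sbtw (i 0) (i k) (partner (i 0)) := by
    rw [← h.strictCyclicMono_coe.sbtw_iff, hover, hover, hunder]
    exact hx hk
  have unique_between : ∀ i j k : Fin 8, Even (i : ℕ) → Even (j : ℕ) → Even (k : ℕ) →
      sbtw i j (partner i) → sbtw i k (partner i) → j = k := by decide
  exact hne (unique_between _ _ _ (hi 0) (hi 1) (hi 2) (hsbtw (by decide)) (hsbtw (by decide)))

theorem KnotDiagram.IsFigureEight.not_sameParity (h : K.IsFigureEight) :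
    ¬ SameParity (arrows K) (arrows K.inverse) := by
  obtain ⟨t, ht, hover⟩ := h.exists_isFigureEightAt
  intro hK
  have hmod := hK.2 ht.finite_arrows
  have hinv (i : Fin 8) : -t i.rev ∈ K.inverse.overpass ↔ t i.rev ∈ K.overpass := by
    simp [KnotDiagram.inverse]
  have odd_rev_iff : ∀ i : Fin 8, Odd (i.rev : ℕ) ↔ Even (i : ℕ) := by decide
  have even_rev_iff : ∀ i : Fin 8, Even (i.rev : ℕ) ↔ Odd (i : ℕ) := by decide
  rcases hover with heven | hodd
  · rw [ht.ncard_patternSets_of_even heven,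
      ht.inverse.ncard_patternSets_of_odd fun i => by rw [hinv, heven, even_rev_iff]] at hmod
    exact absurd hmod (by decide)
  · rw [ht.ncard_patternSets_of_odd hodd,
      ht.inverse.ncard_patternSets_of_even fun i => by rw [hinv, hodd, odd_rev_iff]] at hmod
    exact absurd hmod (by decide)

end FigureEight

end PlaneKnot

theorem theorem1 (K : PlaneKnot.KnotDiagram) (hK : K.IsFigureEight) (n : ℕ)
    (D : Fin (n + 1) → PlaneKnot.KnotDiagram) (kind : Fin n → PlaneKnot.StepKind)
    (hfirst : D 0 = K) (hlast : D (Fin.last n) = K.inverse)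
    (hD : PlaneKnot.IsTransformation D kind) :
    (∃ i, kind i = PlaneKnot.StepKind.omega3Ascending) ∧
    (∃ i, kind i = PlaneKnot.StepKind.omega3Descending) ∧
    2 ≤ {i | kind i = PlaneKnot.StepKind.omega3Ascending ∨
      kind i = PlaneKnot.StepKind.omega3Descending}.ncard := by
  have hasc : ∃ i, kind i = PlaneKnot.StepKind.omega3Ascending := by
    by_contra! h
    have hparity := hD.sameParity h (Fin.last n)
    rw [hfirst, hlast] at hparity
    exact hK.not_sameParity hparity
  have hdesc : ∃ i, kind i = PlaneKnot.StepKind.omega3Descending := by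
    by_contra! h
    have hparity := hD.inverse.sameParity
      (fun i => PlaneKnot.StepKind.reverse_eq_omega3Ascending_iff.not.mpr (h i)) (Fin.last n)
    rw [hfirst, hlast, K.inverse_inverse] at hparity
    exact hK.not_sameParity hparity.symm
  refine ⟨hasc, hdesc, ?_⟩
  obtain ⟨i, hi⟩ := hasc
  obtain ⟨j, hj⟩ := hdesc
  have hij : i ≠ j := fun hij => by simp [hij, hj] at hi
  rw [← Set.ncard_pair hij]
  exact Set.ncard_le_ncard (Set.pair_subset (Or.inl hi) (Or.inr hj)) (Set.toFinite _)
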